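/- Let $M$ be a compact 3-manifold, possibly with boundary, with a finite pseudo-triangulation, that is, a presentation of $M$ as a finite disjoint union of tetrahedra some of whose faces are glued in pairs by affine isomorphisms (two different faces of the same tetrahedron may be glued). Let $F \subset M$ be a nonempty normal surface: a properly embedded surface that meets each tetrahedron in a finite disjoint union of normal discs, i.e. of discs isotopic, by an isotopy of the tetrahedron that leaves each of its simplices invariant, to one of the 4 standard triangles (cutting off one vertex) or one of the 3 standard quadrilaterals (separating two vertices from the other two). Let $Q$ be the total number of normal quadrilaterals of $F$. If $F$ has nonempty boundary (which can happen only if $\partial M \neq \emptyset$), assume that $Q \ge 1$. Then $$\chi(F) \ge 2 - 7Q .$$ In particular, if $F$ is closed, connected and oriented of genus $g$, then $$g \le \tfrac{7}{2}\, Q .$$ -/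

import Mathlib

/-- The standard tetrahedron, in barycentric coordinates. Its vertices are indexed by `Fin 4`; the
coordinate `x.1 i` is `1` at vertex `i` and vanishes on the face opposite to vertex `i`. -/
abbrev Tet : Type := stdSimplex ℝ (Fin 4)

namespace Tet

/-- The (closed) face opposite to vertex `f`. -/
def face (f : Fin 4) : Set Tet := {x | x.1 f = 0}

/-- `x` lies on the 1-skeleton of the tetrahedron. -/
def OnEdge (x : Tet) : Prop := ∃ i j : Fin 4, ∀ k, k ≠ i → k ≠ j → x.1 k = 0

/-- The flat model disc separating the vertices in `A` from the vertices not in `A`.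
If `A` or its complement is a single vertex `i`, it is the triangle that cuts the three edges at `i`
in their midpoints; if `A` has two elements, it is the quadrilateral through the midpoints of the
four edges joining `A` to its complement. `A` and `Aᶜ` give the same disc, so that there are
4 triangles and 3 quadrilaterals. -/
def flatDisc (A : Finset (Fin 4)) : Set Tet := {x | ∑ i ∈ A, x.1 i = 1 / 2}

/-- `D` is a normal disc separating the vertices in `A` from the others: it is the image of the flat
disc at the end of an isotopy of the tetrahedron that leaves each of its simplices invariant. -/
def IsNormalDisc (A : Finset (Fin 4)) (D : Set Tet) : Prop :=
  A.Nonempty ∧ Aᶜ.Nonempty ∧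
  ∃ H : unitInterval → (Tet ≃ₜ Tet),
    Continuous (fun p : unitInterval × Tet => H p.1 p.2) ∧
    H 0 = Homeomorph.refl Tet ∧
    (∀ s x i, (H s x).1 i = 0 ↔ x.1 i = 0) ∧
    D = H 1 '' flatDisc A

/-- `D` is a normal quadrilateral. -/
def IsNormalQuad (D : Set Tet) : Prop := ∃ A : Finset (Fin 4), A.card = 2 ∧ IsNormalDisc A D

end Tet

/-- A 3-dimensional pseudo-triangulation with set of tetrahedra `T`, given by its face gluings.
`adj t f = some (u, σ)` means that the face of `t` opposite to vertex `f` is glued to the face of `u`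
opposite to vertex `σ f`, each vertex `i ≠ f` of the former going to the vertex `σ i` of the latter;
`adj t f = none` means that this face of `t` is not glued to anything, so that it is in the boundary.
Different faces of one tetrahedron may be glued to each other. -/
structure PseudoTriangulation (T : Type*) where
  adj : T → Fin 4 → Option (T × Equiv.Perm (Fin 4))
  adj_symm : ∀ {t f u σ}, adj t f = some (u, σ) → adj u (σ f) = some (t, σ⁻¹)
  adj_ne : ∀ {t f u σ}, adj t f = some (u, σ) → (u, σ f) ≠ (t, f)

namespace PseudoTriangulation

variable {T : Type*} (τ : PseudoTriangulation T)

/-- The elementary identifications between points of the disjoint union of the tetrahedra. -/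
def Glue (p q : Σ _ : T, Tet) : Prop :=
  ∃ f σ, τ.adj p.1 f = some (q.1, σ) ∧ p.2.1 f = 0 ∧ ∀ i, q.2.1 (σ i) = p.2.1 i

/-- The underlying space `M`: the disjoint union of the tetrahedra modulo the equivalence relation
generated by the face gluings. -/
def Space : Type _ := Quot τ.Glue

instance : TopologicalSpace τ.Space := inferInstanceAs (TopologicalSpace (Quot τ.Glue))

/-- The characteristic map of the tetrahedron `t`. -/
def char (t : T) (x : Tet) : τ.Space := Quot.mk τ.Glue ⟨t, x⟩

/-- The boundary of `M`: the union of the faces that are not glued to another face. -/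
def boundary : Set τ.Space := {p | ∃ t f x, τ.adj t f = none ∧ x ∈ Tet.face f ∧ τ.char t x = p}

/-- The corner `i` of the tetrahedron `t` is at the point `v` of `M`. -/
def CornerAt (v : τ.Space) (t : T) (i : Fin 4) : Prop := ∃ x : Tet, x.1 i = 1 ∧ τ.char t x = v

/-- `v` is a vertex of the triangulation. -/
def IsVertex (v : τ.Space) : Prop := ∃ t i, τ.CornerAt v t i

/-! The link `S(v)` of a vertex `v` is the frontier of a small neighbourhood of `v`: the union over
all corners `(t, i)` at `v` of the triangles `{x | x i = 2 / 3}` in `t`. As `v` is a point of `M` and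
the identifications are generated by the face gluings, `S(v)` is a connected compact surface, with
boundary exactly if some unglued face contains `v`. -/

/-- The vertices of the link: the points in which it meets the edges of the triangulation. -/
def linkVertices (v : τ.Space) : Set τ.Space :=
  {p | ∃ t i j, ∃ x : Tet, i ≠ j ∧ τ.CornerAt v t i ∧ x.1 i = 2 / 3 ∧ x.1 j = 1 / 3 ∧
    p = τ.char t x}

/-- The edges of the link: the arcs in which it meets the faces of the triangulation. -/
def linkEdges (v : τ.Space) : Set (Set τ.Space) :=
  {a | ∃ t i f, i ≠ f ∧ τ.CornerAt v t i ∧ a = τ.char t '' {x | x.1 i = 2 / 3 ∧ x ∈ Tet.face f}}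

/-- The triangles of the link: one for each corner at `v`. -/
def linkTriangles (v : τ.Space) : Set (T × Fin 4) := {c | τ.CornerAt v c.1 c.2}

/-- The Euler characteristic of the link of `v`. -/
noncomputable def linkEulerChar (v : τ.Space) : ℤ :=
  ((τ.linkVertices v).ncard : ℤ) - (τ.linkEdges v).ncard + (τ.linkTriangles v).ncard

/-- `τ` triangulates a 3-manifold (possibly with boundary): the link of each vertex is a sphere (a
connected closed surface of Euler characteristic 2) if the vertex is not in the boundary, and a disc
(a connected compact surface with nonempty boundary, of Euler characteristic 1) if it is; and no
edge is identified with itself in the reverse direction. -/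
structure IsManifold : Prop where
  link_sphere : ∀ v, τ.IsVertex v → v ∉ τ.boundary → τ.linkEulerChar v = 2
  link_disc : ∀ v, τ.IsVertex v → v ∈ τ.boundary → τ.linkEulerChar v = 1
  edge_ne_reverse : ∀ t i j, ∀ x y : Tet, i ≠ j → x.1 i = 2 / 3 → x.1 j = 1 / 3 →
    y.1 i = 1 / 3 → y.1 j = 2 / 3 → τ.char t x ≠ τ.char t y

end PseudoTriangulation

/-- A normal surface in the triangulated space: a subset whose preimage in each tetrahedron is a
finite disjoint union of normal discs. (The discs are the connected components of the preimage.) -/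
structure NormalSurface {T : Type*} (τ : PseudoTriangulation T) where
  carrier : Set τ.Space
  discs : T → Set (Set Tet)
  discs_finite : ∀ t, (discs t).Finite
  discs_normal : ∀ t, ∀ D ∈ discs t, ∃ A, Tet.IsNormalDisc A D
  discs_disjoint : ∀ t, (discs t).PairwiseDisjoint id
  sUnion_discs : ∀ t, ⋃₀ discs t = τ.char t ⁻¹' carrier

namespace NormalSurface

variable {T : Type*} {τ : PseudoTriangulation T} (F : NormalSurface τ)

/-- The number of normal quadrilaterals of `F`. -/
noncomputable def numQuads [Fintype T] : ℕ := ∑ t, {D ∈ F.discs t | Tet.IsNormalQuad D}.ncard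

/-! The normal discs of `F` are the 2-cells of a cell decomposition of `F`. -/

/-- The 0-cells: the points in which `F` meets the edges of the triangulation. -/
def vertices : Set τ.Space := {p ∈ F.carrier | ∃ t, ∃ x : Tet, x.OnEdge ∧ τ.char t x = p}

/-- The 1-cells: the normal arcs in which the discs of `F` meet the faces of the triangulation. -/
def arcs : Set (Set τ.Space) :=
  {a | ∃ t, ∃ D ∈ F.discs t, ∃ f, (D ∩ Tet.face f).Nonempty ∧ a = τ.char t '' (D ∩ Tet.face f)}

/-- The Euler characteristic of `F`. -/
noncomputable def eulerChar [Fintype T] : ℤ :=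
  (F.vertices.ncard : ℤ) - F.arcs.ncard + ∑ t, ((F.discs t).ncard : ℤ)

/-- `F` has empty boundary, that is, it does not meet the boundary of `M`. -/
def IsClosedSurface : Prop := Disjoint F.carrier τ.boundary

/-- `F` is orientable. Each tetrahedron has the orientation given by the order of its vertices, so
an orientation of a normal disc `D` in it amounts to a choice of one of the two sides of `D`, recorded
as the set of the vertices on this side. Orientations of tetrahedra glued along a face by `σ` agree
there if and only if `σ` is odd; so two discs with a common arc in this face are coherently oriented
if and only if the chosen sides agree at the arc when `σ` is odd and are opposite when `σ` is even. -/
def IsOrientable : Prop :=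
  ∃ side : T → Set Tet → Finset (Fin 4),
    (∀ t, ∀ D ∈ F.discs t, Tet.IsNormalDisc (side t D) D) ∧
    ∀ t f u σ, τ.adj t f = some (u, σ) → ∀ D ∈ F.discs t, ∀ E ∈ F.discs u,
      (D ∩ Tet.face f).Nonempty →
      τ.char t '' (D ∩ Tet.face f) = τ.char u '' (E ∩ Tet.face (σ f)) →
      ∀ i, i ≠ f → (σ i ∈ side u E ↔ (i ∈ side t D ↔ Equiv.Perm.sign σ = -1))

/-- `F` is a closed, connected, orientable surface of genus `g`. -/
structure IsClosedOrientableOfGenus [Fintype T] (g : ℕ) : Prop where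
  closed : F.IsClosedSurface
  connected : IsConnected F.carrier
  orientable : F.IsOrientable
  euler : F.eulerChar = 2 - 2 * g

end NormalSurface

/-!
Why the inequality holds. The points of the normal surface `F` on an edge of a tetrahedron, seen from
an end `i` of the edge, have levels `0, 1, 2, …`, and these are preserved by the face gluings. Two
disjoint discs lie on one side of each other; hence a disc that cuts off `i` in a face has the same
level on both edges at `i` (`NormalSurface.level_eq_of_mem_disc`), and a triangle of `F` at a vertex
`v` of `M` continues across a face as a triangle at `v` of the same level or as a quadrilateral
(`NormalSurface.exists_glued_triangle`). So the triangles of level `k` at `v` form a *layer*, which is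
a copy of a set `X` of triangles of the link `S(v)`, and `F` consists of its layers and its `Q`
quadrilaterals.

Let `V(X)` be the number of vertices of `S(v)` on `X`, and `E°(X)` the number of edges of `S(v)` all of
whose adjacent triangles are in `X`. If `X` is nonempty, then `V(X) - E°(X) + |X| ≥ χ(S(v))`
(`PseudoTriangulation.linkEulerChar_le`). In other words, the triangles outside `X` and the vertices
not on `X` are together at most as many as the edges with an adjacent triangle outside `X`. Indeed,
with coefficients modulo 2, the boundary map on the former and the coboundary map on the latter are
injective, because the link is connected, and their images in the functions on these edges are
orthogonal, because a boundary has no boundary. One edge between `X` and its complement may be left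
out in this argument if it is not a loop, which makes the inequality strict
(`PseudoTriangulation.linkEulerChar_lt`).

Now count the cells of `F`. An arc that is not one of the at most `4 Q` sides of quadrilaterals comes
from an edge counted in `E°(X)` for one layer `X` (`NormalSurface.ncard_arcs_le`). A vertex of `F` is
on at most two layers, one for each end of its edge, and on two only if it is one of the at most `4 Q`
corners of quadrilaterals (`NormalSurface.sum_ncard_verticesOf_le`). Therefore `χ(F)` is at least
`Q - 4 Q - 4 Q` plus the sum over all layers of `V(X) - E°(X) + |X|`, each of which is at least
`χ(S(v)) ≥ 1`.

It remains to find `2` on top of `-7 Q`. If `Q = 0`, then `F` is closed and each layer is a whole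
link, which is a sphere. If `Q ≥ 1` and there are no layers, the vertices need not be estimated at all
and `4 Q ≥ 2` is left over. Otherwise the layers contribute at least `1`, and one more is gained as
follows: either two corners of quadrilaterals are the same point, or some corner of a quadrilateral is
on no layer, or some layer is bordered by a side of a quadrilateral whose ends are distinct, so that
the strict inequality applies to it (`NormalSurface.exists_two_le_contribution`).
-/

/-! ### Points, edges and symmetries of the tetrahedron -/

namespace Tet

/-- The vertex `i` of the tetrahedron. -/
def vertex (i : Fin 4) : Tet := ⟨Pi.single i 1, single_mem_stdSimplex ℝ i⟩

/-- The closed edge joining the vertices `i` and `j`. -/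
def edge (i j : Fin 4) : Set Tet := {x | ∀ k, k ≠ i → k ≠ j → x.1 k = 0}

/-- The affine automorphism of the tetrahedron that sends each vertex `i` to the vertex `σ i`. -/
def perm (σ : Equiv.Perm (Fin 4)) (x : Tet) : Tet :=
  ⟨fun j => x.1 (σ.symm j), fun j => x.2.1 _, by
    rw [← x.2.2]; exact Equiv.sum_comp σ.symm x.1⟩

@[simp] lemma perm_apply (σ : Equiv.Perm (Fin 4)) (x : Tet) (i : Fin 4) :
    (perm σ x).1 (σ i) = x.1 i := by simp [perm]

lemma perm_eq {σ : Equiv.Perm (Fin 4)} {x y : Tet} (h : ∀ i, y.1 (σ i) = x.1 i) :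
    y = perm σ x := by
  apply Subtype.ext; funext j
  obtain ⟨i, rfl⟩ := σ.surjective j
  rw [h, perm_apply]

lemma continuous_perm (σ : Equiv.Perm (Fin 4)) : Continuous (perm σ) := by
  have hval : Continuous fun x : Tet => x.1 := continuous_subtype_val
  exact Continuous.subtype_mk (continuous_pi fun j => (continuous_apply (σ.symm j)).comp hval) _

lemma perm_inv_perm (σ : Equiv.Perm (Fin 4)) (x : Tet) : perm σ⁻¹ (perm σ x) = x := by
  symm; apply perm_eq; intro i
  obtain ⟨j, rfl⟩ := σ.surjective i
  simp

lemma perm_perm_inv (σ : Equiv.Perm (Fin 4)) (x : Tet) : perm σ (perm σ⁻¹ x) = x := by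
  simpa using perm_inv_perm σ⁻¹ x

lemma perm_vertex (σ : Equiv.Perm (Fin 4)) (i : Fin 4) : perm σ (vertex i) = vertex (σ i) := by
  symm; apply perm_eq; intro j
  simp [vertex, Pi.single_apply]

lemma perm_mem_edge {σ : Equiv.Perm (Fin 4)} {x : Tet} {i j : Fin 4} :
    perm σ x ∈ edge (σ i) (σ j) ↔ x ∈ edge i j := by
  constructor
  · intro h k hi hj
    simpa using h (σ k) (by simpa using hi) (by simpa using hj)
  · intro h k hi hj
    obtain ⟨l, rfl⟩ := σ.surjective k
    rw [perm_apply]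
    exact h l (by simpa using hi) (by simpa using hj)

lemma perm_mem_face {σ : Equiv.Perm (Fin 4)} {x : Tet} {f : Fin 4} :
    perm σ x ∈ face (σ f) ↔ x ∈ face f := by
  simp [face]

lemma edge_comm (i j : Fin 4) : edge i j = edge j i := by
  ext x; constructor <;> exact fun h k h1 h2 => h k h2 h1

lemma vertex_mem_edge_left (i j : Fin 4) : vertex i ∈ edge i j := by
  intro k hk _; simp [vertex, hk]

lemma vertex_mem_edge_right (i j : Fin 4) : vertex j ∈ edge i j := by
  intro k _ hk; simp [vertex, hk]

lemma edge_subset_face {i j f : Fin 4} (hi : i ≠ f) (hj : j ≠ f) : edge i j ⊆ face f :=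
  fun _ hx => hx f hi.symm hj.symm

lemma add_eq_one_of_mem_edge {x : Tet} {i j : Fin 4} (hij : i ≠ j) (hx : x ∈ edge i j) :
    x.1 i + x.1 j = 1 := by
  rw [← x.2.2]
  rw [← Finset.sum_subset (Finset.subset_univ {i, j}), Finset.sum_pair hij]
  intro k _ hk
  simp only [Finset.mem_insert, Finset.mem_singleton, not_or] at hk
  exact hx k hk.1 hk.2

lemma eq_of_mem_edge {x y : Tet} {i j : Fin 4} (hij : i ≠ j) (hx : x ∈ edge i j)
    (hy : y ∈ edge i j) (h : x.1 i = y.1 i) : x = y := by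
  apply Subtype.ext; funext k
  by_cases hi : k = i
  · rw [hi, h]
  by_cases hj : k = j
  · have := add_eq_one_of_mem_edge hij hx
    have := add_eq_one_of_mem_edge hij hy
    rw [hj]; linarith
  · rw [hx k hi hj, hy k hi hj]

lemma eq_vertex_of_apply_eq_one {x : Tet} {i : Fin 4} (h : x.1 i = 1) : x = vertex i := by
  have hs := x.2.2
  rw [← Finset.add_sum_erase _ _ (Finset.mem_univ i), h] at hs
  have h0 : ∑ k ∈ Finset.univ.erase i, x.1 k = 0 := by linarith
  rw [Finset.sum_eq_zero_iff_of_nonneg fun k _ => x.2.1 k] at h0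
  apply Subtype.ext; funext k
  by_cases hk : k = i
  · rw [hk, h]; simp [vertex]
  · rw [h0 k (by simp [hk])]; simp [vertex, hk]

/-- The point of the edge from `i` to `j` that divides it in the ratio `1 : 2`. -/
noncomputable def third (i j : Fin 4) : Tet :=
  ⟨fun k => 2 / 3 * (vertex i).1 k + 1 / 3 * (vertex j).1 k,
    fun k => by have := (vertex i).2.1 k; have := (vertex j).2.1 k; positivity, by
      rw [Finset.sum_add_distrib, ← Finset.mul_sum, ← Finset.mul_sum, (vertex i).2.2,
        (vertex j).2.2]; norm_num⟩

lemma third_left {i j : Fin 4} (h : i ≠ j) : (third i j).1 i = 2 / 3 := by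
  simp [third, vertex, h]

lemma third_right {i j : Fin 4} (h : i ≠ j) : (third i j).1 j = 1 / 3 := by
  simp [third, vertex, h.symm]

lemma third_other {i j k : Fin 4} (hi : k ≠ i) (hj : k ≠ j) : (third i j).1 k = 0 := by
  simp [third, vertex, hi, hj]

lemma eq_third {x : Tet} {i j : Fin 4} (hij : i ≠ j) (hi : x.1 i = 2 / 3) (hj : x.1 j = 1 / 3) :
    x = third i j := by
  have hs := x.2.2
  rw [← Finset.add_sum_erase _ _ (Finset.mem_univ i),
    ← Finset.add_sum_erase _ _ (Finset.mem_erase.2 ⟨hij.symm, Finset.mem_univ j⟩), hi, hj] at hs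
  have h0 : ∑ k ∈ (Finset.univ.erase i).erase j, x.1 k = 0 := by linarith
  rw [Finset.sum_eq_zero_iff_of_nonneg fun k _ => x.2.1 k] at h0
  apply Subtype.ext; funext k
  by_cases hk : k = i
  · rw [hk, hi, third_left hij]
  by_cases hk' : k = j
  · rw [hk', hj, third_right hij]
  rw [h0 k (by simp [hk, hk']), third_other hk hk']

lemma perm_third (σ : Equiv.Perm (Fin 4)) (i j : Fin 4) :
    perm σ (third i j) = third (σ i) (σ j) := by
  symm; apply perm_eq; intro k
  simp [third, vertex, Pi.single_apply]

/-! ### Normal discs -/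

lemma isPreconnected_of_convex {C : Set (Fin 4 → ℝ)} (hC : Convex ℝ C) :
    IsPreconnected {x : Tet | x.1 ∈ C} := by
  rw [← Topology.IsInducing.subtypeVal.isPreconnected_image]
  have : (Subtype.val '' {x : Tet | x.1 ∈ C}) = stdSimplex ℝ (Fin 4) ∩ C := by
    ext y; constructor
    · rintro ⟨x, hx, rfl⟩; exact ⟨x.2, hx⟩
    · rintro ⟨h1, h2⟩; exact ⟨⟨y, h1⟩, h2, rfl⟩
  rw [this]
  exact ((convex_stdSimplex ℝ (Fin 4)).inter hC).isPreconnected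

lemma pos_of_isPreconnected {s : Set Tet} (hs : IsPreconnected s) {g : Tet → ℝ}
    (hg : Continuous g) (h0 : ∀ x ∈ s, g x ≠ 0) {a b : Tet} (ha : a ∈ s) (hb : b ∈ s)
    (hpos : 0 < g a) : 0 < g b := by
  by_contra hneg
  obtain ⟨c, hc, hc0⟩ := hs.intermediate_value hb ha hg.continuousOn ⟨not_lt.1 hneg, hpos.le⟩
  exact h0 c hc hc0

lemma sum_compl (A : Finset (Fin 4)) (x : Tet) : ∑ i ∈ Aᶜ, x.1 i = 1 - ∑ i ∈ A, x.1 i := by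
  have := Finset.sum_add_sum_compl A x.1
  rw [x.2.2] at this; linarith

lemma flatDisc_compl (A : Finset (Fin 4)) : flatDisc Aᶜ = flatDisc A := by
  ext x
  simp only [flatDisc, Set.mem_ofPred_eq, sum_compl]
  constructor <;> intro h <;> linarith

namespace IsNormalDisc

variable {A B : Finset (Fin 4)} {D E : Set Tet}

lemma compl (h : IsNormalDisc A D) : IsNormalDisc Aᶜ D := by
  obtain ⟨h1, h2, H, h3, h4, h5, h6⟩ := h
  exact ⟨h2, by simpa using h1, H, h3, h4, h5, by rw [flatDisc_compl, h6]⟩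

lemma exists_homeo (h : IsNormalDisc A D) :
    ∃ φ : Tet ≃ₜ Tet, (∀ x i, (φ x).1 i = 0 ↔ x.1 i = 0) ∧ D = φ '' flatDisc A := by
  obtain ⟨-, -, H, -, -, h5, h6⟩ := h
  exact ⟨H 1, h5 1, h6⟩

lemma convex_sum_eq (A : Finset (Fin 4)) : Convex ℝ {x : Fin 4 → ℝ | ∑ i ∈ A, x i = 1 / 2} := by
  have : {x : Fin 4 → ℝ | ∑ i ∈ A, x i = 1 / 2} =
      (∑ i ∈ A, LinearMap.proj i : (Fin 4 → ℝ) →ₗ[ℝ] ℝ) ⁻¹' {1 / 2} := by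
    ext x; simp
  rw [this]
  exact (convex_singleton _).linear_preimage _

lemma convex_apply_eq (f : Fin 4) (c : ℝ) : Convex ℝ {x : Fin 4 → ℝ | x f = c} :=
  (convex_singleton c).linear_preimage (LinearMap.proj f : (Fin 4 → ℝ) →ₗ[ℝ] ℝ)

lemma isPreconnected (h : IsNormalDisc A D) : IsPreconnected D := by
  obtain ⟨φ, -, rfl⟩ := h.exists_homeo
  exact (isPreconnected_of_convex (convex_sum_eq A)).image _ φ.continuous.continuousOn

lemma isPreconnected_inter_face (h : IsNormalDisc A D) (f : Fin 4) :
    IsPreconnected (D ∩ face f) := by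
  obtain ⟨φ, hφ, rfl⟩ := h.exists_homeo
  have : φ '' flatDisc A ∩ face f = φ '' (flatDisc A ∩ face f) := by
    ext y; constructor
    · rintro ⟨⟨x, hx, rfl⟩, hf⟩; exact ⟨x, ⟨hx, (hφ x f).1 hf⟩, rfl⟩
    · rintro ⟨x, ⟨hx, hf⟩, rfl⟩; exact ⟨⟨x, hx, rfl⟩, (hφ x f).2 hf⟩
  rw [this]
  exact (isPreconnected_of_convex ((convex_sum_eq A).inter (convex_apply_eq f 0))).image _
    φ.continuous.continuousOn

lemma isClosed (h : IsNormalDisc A D) : IsClosed D := by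
  obtain ⟨φ, -, rfl⟩ := h.exists_homeo
  rw [φ.isClosed_image]
  exact isClosed_eq (by fun_prop) continuous_const

lemma map_edge {φ : Tet ≃ₜ Tet} (hφ : ∀ x i, (φ x).1 i = 0 ↔ x.1 i = 0) {x : Tet} {i j : Fin 4} :
    φ x ∈ edge i j ↔ x ∈ edge i j :=
  ⟨fun h k h1 h2 => (hφ x k).1 (h k h1 h2), fun h k h1 h2 => (hφ x k).2 (h k h1 h2)⟩

lemma sum_eq_apply {x : Tet} {i j : Fin 4} (hi : i ∈ A) (hj : j ∉ A) (hx : x ∈ edge i j) :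
    ∑ k ∈ A, x.1 k = x.1 i := by
  refine Finset.sum_eq_single_of_mem i hi fun k hk hki => hx k hki ?_
  rintro rfl; exact hj hk

lemma exists_mem_edge (h : IsNormalDisc A D) {i j : Fin 4} (hi : i ∈ A) (hj : j ∉ A) :
    ∃ p, p ∈ D ∧ p ∈ edge i j := by
  obtain ⟨φ, hφ, rfl⟩ := h.exists_homeo
  have hij : i ≠ j := fun e => hj (e ▸ hi)
  let m : Tet := ⟨fun k => 1 / 2 * (vertex i).1 k + 1 / 2 * (vertex j).1 k,
    fun k => by have := (vertex i).2.1 k; have := (vertex j).2.1 k; positivity, by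
      rw [Finset.sum_add_distrib, ← Finset.mul_sum, ← Finset.mul_sum, (vertex i).2.2,
        (vertex j).2.2]; norm_num⟩
  have hm : m ∈ edge i j := fun k h1 h2 => by simp [m, vertex, h1, h2]
  refine ⟨φ m, ⟨m, ?_, rfl⟩, (map_edge hφ).2 hm⟩
  show ∑ k ∈ A, m.1 k = 1 / 2
  rw [sum_eq_apply hi hj hm]
  simp [m, vertex, hij]

lemma eq_of_mem_edge (h : IsNormalDisc A D) {i j : Fin 4} (hi : i ∈ A) (hj : j ∉ A) {p q : Tet}
    (hp : p ∈ D) (hp' : p ∈ edge i j) (hq : q ∈ D) (hq' : q ∈ edge i j) : p = q := by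
  obtain ⟨φ, hφ, rfl⟩ := h.exists_homeo
  obtain ⟨x, hx, rfl⟩ := hp
  obtain ⟨y, hy, rfl⟩ := hq
  rw [map_edge hφ] at hp' hq'
  have hij : i ≠ j := fun e => hj (e ▸ hi)
  have h1 : ∑ k ∈ A, x.1 k = 1 / 2 := hx
  have h2 : ∑ k ∈ A, y.1 k = 1 / 2 := hy
  rw [sum_eq_apply hi hj hp'] at h1
  rw [sum_eq_apply hi hj hq'] at h2
  rw [Tet.eq_of_mem_edge hij hp' hq' (h1.trans h2.symm)]

/-- A disc is disjoint from the edges whose ends it does not separate. -/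
lemma notMem_of_mem_edge (h : IsNormalDisc A D) {i j : Fin 4} (hij : i ∈ A ↔ j ∈ A) {p : Tet}
    (hp : p ∈ edge i j) : p ∉ D := by
  wlog hA : i ∈ A generalizing A
  · refine this h.compl ?_ ?_ <;> simp_all
  intro hD
  obtain ⟨φ, hφ, rfl⟩ := h.exists_homeo
  obtain ⟨x, hx, rfl⟩ := hD
  rw [map_edge hφ] at hp
  have h1 : ∑ k ∈ A, x.1 k = 1 / 2 := hx
  have h2 : ∑ k ∈ A, x.1 k = 1 := by
    rw [← x.2.2]
    refine Finset.sum_subset (Finset.subset_univ _) fun k _ hk => hp k ?_ ?_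
    · rintro rfl; exact hk hA
    · rintro rfl; exact hk (hij.1 hA)
  linarith

lemma separates_of_mem_edge (h : IsNormalDisc A D) {i j : Fin 4} {p : Tet} (hD : p ∈ D)
    (hp : p ∈ edge i j) : ¬(i ∈ A ↔ j ∈ A) := fun hij => h.notMem_of_mem_edge hij hp hD

/-- A function whose sign tells on which side of `D` a point lies. -/
lemma exists_side (h : IsNormalDisc A D) : ∃ g : Tet → ℝ, Continuous g ∧ (∀ y, g y = 0 ↔ y ∈ D) ∧
    (∀ i ∈ A, 0 < g (vertex i)) ∧ ∀ i, i ∉ A → g (vertex i) < 0 := by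
  obtain ⟨φ, hφ, rfl⟩ := h.exists_homeo
  have hv : ∀ i, φ.symm (vertex i) = vertex i := by
    intro i
    have h1 : φ.symm (vertex i) ∈ edge i i := by
      rw [← map_edge hφ, φ.apply_symm_apply]; exact vertex_mem_edge_left i i
    apply eq_vertex_of_apply_eq_one
    rw [← (φ.symm (vertex i)).2.2, Finset.sum_eq_single i]
    · intro k _ hk; exact h1 k hk hk
    · simp
  refine ⟨fun y => ∑ i ∈ A, (φ.symm y).1 i - 1 / 2, ?_, ?_, ?_, ?_⟩
  · have := φ.symm.continuous
    fun_prop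
  · intro y
    rw [sub_eq_zero]
    constructor
    · intro hy; exact ⟨φ.symm y, hy, φ.apply_symm_apply y⟩
    · rintro ⟨x, hx, rfl⟩; rw [φ.symm_apply_apply]; exact hx
  · intro i hi
    beta_reduce
    rw [hv]
    norm_num [vertex, Finset.sum_pi_single]
    rw [if_pos hi]; norm_num
  · intro i hi
    beta_reduce
    rw [hv]
    norm_num [vertex, Finset.sum_pi_single]
    rw [if_neg hi]; norm_num

/-- On an edge that meets `D`, the two sides of `D` are the two sides of the common point. -/
lemma side_pos_iff (h : IsNormalDisc A D) {g : Tet → ℝ} (hg : Continuous g)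
    (hg0 : ∀ y, g y = 0 ↔ y ∈ D) (hpos : ∀ i ∈ A, 0 < g (vertex i))
    (hneg : ∀ i, i ∉ A → g (vertex i) < 0) {i j : Fin 4} (hi : i ∈ A) (hj : j ∉ A) {p y : Tet}
    (hp : p ∈ D) (hpe : p ∈ edge i j) (hy : y ∈ edge i j) : 0 < g y ↔ p.1 i < y.1 i := by
  have hij : i ≠ j := fun e => hj (e ▸ hi)
  have hedge : Convex ℝ {x : Fin 4 → ℝ | ∀ k, k ≠ i → k ≠ j → x k = 0} := by
    have : {x : Fin 4 → ℝ | ∀ k, k ≠ i → k ≠ j → x k = 0} =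
        ⋂ k, ⋂ (_ : k ≠ i), ⋂ (_ : k ≠ j), {x | x k = 0} := by ext; simp
    rw [this]
    exact convex_iInter fun k => convex_iInter fun _ => convex_iInter fun _ => convex_apply_eq k 0
  have hmem : ∀ z ∈ edge i j, z ∈ D → z = p := fun z hz hzD =>
    h.eq_of_mem_edge hi hj hzD hz hp hpe
  have hle : (vertex i).1 i = 1 ∧ (vertex j).1 i = 0 := by simp [vertex, hij]
  have hy1 := add_eq_one_of_mem_edge hij hy
  have hy0 := y.2.1 i
  have hy0' := y.2.1 j
  constructor
  · intro hgy
    by_contra hlt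
    rcases (not_lt.1 hlt).lt_or_eq with hlt | heq
    · have hs := isPreconnected_of_convex (hedge.inter
        ((convex_Iic (y.1 i)).linear_preimage (LinearMap.proj i : (Fin 4 → ℝ) →ₗ[ℝ] ℝ)))
      have := pos_of_isPreconnected hs hg (a := y) (b := vertex j) ?_ ⟨hy, le_refl (y.1 i)⟩
        ⟨vertex_mem_edge_right i j, show (vertex j).1 i ≤ y.1 i by rw [hle.2]; exact hy0⟩ hgy
      · exact (hneg j hj).not_gt this
      · rintro z ⟨hz, hz'⟩ h0
        have hz' : z.1 i ≤ y.1 i := hz'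
        rw [hmem z hz ((hg0 z).1 h0)] at hz'
        linarith
    · rw [Tet.eq_of_mem_edge hij hy hpe heq, (hg0 p).2 hp] at hgy
      exact lt_irrefl _ hgy
  · intro hlt
    have hs := isPreconnected_of_convex (hedge.inter
        ((convex_Ici (y.1 i)).linear_preimage (LinearMap.proj i : (Fin 4 → ℝ) →ₗ[ℝ] ℝ)))
    refine pos_of_isPreconnected hs hg ?_ (a := vertex i) ⟨vertex_mem_edge_left i j,
      show y.1 i ≤ (vertex i).1 i by rw [hle.1]; linarith⟩ ⟨hy, le_refl (y.1 i)⟩ (hpos i hi)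
    rintro z ⟨hz, hz'⟩ h0
    have hz' : y.1 i ≤ z.1 i := hz'
    rw [hmem z hz ((hg0 z).1 h0)] at hz'
    linarith

/-- If `D` separates `i` from `j` and `k`, then every disc disjoint from `D` that meets the edge
`ij` nearer to `i` than `D` does so on the edge `ik` too: it lies on the side of `i`, hence cannot
meet the edge `jk`. -/
lemma exists_nearer (h : IsNormalDisc A D) (hE : IsNormalDisc B E) (hdisj : Disjoint D E)
    {i j k : Fin 4} (hij : ¬(i ∈ A ↔ j ∈ A)) (hik : ¬(i ∈ A ↔ k ∈ A)) {p q y : Tet}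
    (hp : p ∈ D) (hpe : p ∈ edge i j) (hq : q ∈ D) (hqe : q ∈ edge i k) (hy : y ∈ E)
    (hye : y ∈ edge i j) (hlt : p.1 i < y.1 i) : ∃ z ∈ E, z ∈ edge i k ∧ q.1 i < z.1 i := by
  wlog hi : i ∈ A generalizing A
  · refine this h.compl ?_ ?_ ?_ <;> simp_all
  have hj : j ∉ A := by simp_all
  have hk : k ∉ A := by simp_all
  obtain ⟨g, hg, hg0, hpos, hneg⟩ := h.exists_side
  have hgy : 0 < g y := (h.side_pos_iff hg hg0 hpos hneg hi hj hp hpe hye).2 hlt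
  have hgE : ∀ z ∈ E, 0 < g z := fun z hz => pos_of_isPreconnected hE.isPreconnected hg
    (fun x hx h0 => Set.disjoint_left.1 hdisj ((hg0 x).1 h0) hx) hy hz hgy
  have hijB := hE.separates_of_mem_edge hy hye
  have key : ∀ a b : Fin 4, ¬(a ∈ B ↔ b ∈ B) → ∃ z ∈ E, z ∈ edge a b := by
    intro a b hab
    by_cases ha : a ∈ B
    · exact hE.exists_mem_edge ha (by tauto)
    · obtain ⟨z, hz, hz'⟩ := hE.exists_mem_edge (i := b) (j := a) (by tauto) ha
      exact ⟨z, hz, by rwa [edge_comm]⟩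
  by_cases hikB : i ∈ B ↔ k ∈ B
  · exfalso
    obtain ⟨z, hz, hze⟩ := key j k (by tauto)
    have hconv : IsPreconnected (edge j k) := by
      have := isPreconnected_of_convex (C := {x | ∀ l, l ≠ j → l ≠ k → x l = 0}) ?_
      · exact this
      · have : {x : Fin 4 → ℝ | ∀ l, l ≠ j → l ≠ k → x l = 0} =
            ⋂ l, ⋂ (_ : l ≠ j), ⋂ (_ : l ≠ k), {x | x l = 0} := by ext; simp
        rw [this]
        exact convex_iInter fun l => convex_iInter fun _ => convex_iInter fun _ =>
          convex_apply_eq l 0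
    have := pos_of_isPreconnected hconv hg (fun x hx h0 =>
      h.notMem_of_mem_edge (by tauto) hx ((hg0 x).1 h0)) hze (vertex_mem_edge_left j k) (hgE z hz)
    exact (hneg j hj).not_gt this
  · obtain ⟨z, hz, hze⟩ := key i k hikB
    exact ⟨z, hz, hze, (h.side_pos_iff hg hg0 hpos hneg hi hk hq hqe hze).1 (hgE z hz)⟩

/-- A disc that meets the face opposite to `f` separates two vertices of this face. -/
lemma exists_separated_of_inter_face (h : IsNormalDisc A D) {f : Fin 4}
    (hf : (D ∩ face f).Nonempty) : ∃ i ∈ A, ∃ j, j ∉ A ∧ i ≠ f ∧ j ≠ f := by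
  have key : ∀ B : Finset (Fin 4), IsNormalDisc B D → ∃ i ∈ B, i ≠ f := by
    intro B hB
    by_contra hcon
    push Not at hcon
    obtain ⟨φ, hφ, rfl⟩ := hB.exists_homeo
    obtain ⟨_, ⟨x, hx, rfl⟩, hxf⟩ := hf
    have hx1 : ∑ k ∈ B, x.1 k = 1 / 2 := hx
    rw [Finset.sum_eq_zero] at hx1
    · norm_num at hx1
    · intro k hk; rw [hcon k hk]; exact (hφ x f).1 hxf
  obtain ⟨i, hi, hif⟩ := key A h
  obtain ⟨j, hj, hjf⟩ := key Aᶜ h.compl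
  exact ⟨i, hi, j, by simpa using hj, hif, hjf⟩

/-- The set of the edges met by a disc determines its type up to complement. -/
lemma type_unique (hA : IsNormalDisc A D) (hB : IsNormalDisc B D) : B = A ∨ B = Aᶜ := by
  have aux : ∀ {A B : Finset (Fin 4)}, IsNormalDisc A D → IsNormalDisc B D → ∀ i j,
      (i ∈ B ↔ j ∈ B) → (i ∈ A ↔ j ∈ A) := by
    intro A B hA hB i j hij
    by_contra hcon
    wlog hi : i ∈ A generalizing i j
    · exact this j i hij.symm (by tauto) (by tauto)
    obtain ⟨p, hp, hpe⟩ := hA.exists_mem_edge hi (j := j) (by tauto)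
    exact hB.separates_of_mem_edge hp hpe hij
  have key : ∀ i j, (i ∈ A ↔ j ∈ A) ↔ (i ∈ B ↔ j ∈ B) := fun i j =>
    ⟨aux hB hA i j, aux hA hB i j⟩
  by_cases h0 : (0 : Fin 4) ∈ A ↔ (0 : Fin 4) ∈ B
  · left; ext i; have := key i 0; tauto
  · right; ext i; have := key i 0; rw [Finset.mem_compl]; tauto

end IsNormalDisc

/-- `D` is a normal triangle cutting off the vertex `i`. -/
def IsNormalTriangle (i : Fin 4) (D : Set Tet) : Prop := IsNormalDisc {i} D

lemma IsNormalDisc.triangle_or_quad {A : Finset (Fin 4)} {D : Set Tet} (h : IsNormalDisc A D) :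
    (∃ i, IsNormalTriangle i D) ∨ IsNormalQuad D := by
  have h1 : 0 < A.card := h.1.card_pos
  have h2 : 0 < Aᶜ.card := h.2.1.card_pos
  have h3 := Finset.card_add_card_compl A
  rw [Fintype.card_fin] at h3
  have : A.card = 1 ∨ A.card = 2 ∨ Aᶜ.card = 1 := by omega
  rcases this with h4 | h4 | h4
  · obtain ⟨i, rfl⟩ := Finset.card_eq_one.1 h4
    exact Or.inl ⟨i, h⟩
  · exact Or.inr ⟨A, h4, h⟩
  · obtain ⟨i, hi⟩ := Finset.card_eq_one.1 h4
    exact Or.inl ⟨i, by have := h.compl; rwa [hi] at this⟩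

lemma IsNormalTriangle.not_quad {i : Fin 4} {D : Set Tet} (h : IsNormalTriangle i D) :
    ¬IsNormalQuad D := by
  rintro ⟨A, hA, hD⟩
  rcases h.type_unique hD with rfl | rfl
  · simp at hA
  · simp [Finset.card_compl] at hA

lemma IsNormalTriangle.unique {i j : Fin 4} {D : Set Tet} (hi : IsNormalTriangle i D)
    (hj : IsNormalTriangle j D) : j = i := by
  rcases hi.type_unique hj with h | h
  · simpa using h
  · have := congrArg Finset.card h
    simp [Finset.card_compl] at this

/-- A disc that cuts off the vertex `i` in a face without being the triangle at `i` is a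
quadrilateral, as the only other triangle that meets the edges `ij` and `ik` would have to be at
`j` and at `k`. -/
lemma IsNormalDisc.triangle_or_quad_of_mem_edge {A : Finset (Fin 4)} {D : Set Tet}
    (h : IsNormalDisc A D) {i j k : Fin 4} (hij : ¬(i ∈ A ↔ j ∈ A)) (hik : ¬(i ∈ A ↔ k ∈ A))
    (hjk : j ≠ k) : IsNormalTriangle i D ∨ IsNormalQuad D := by
  rcases h.triangle_or_quad with ⟨l, hl⟩ | hq
  · left
    have : l = i := by
      rcases hl.type_unique h with rfl | rfl <;>
      · simp only [Finset.mem_compl, Finset.mem_singleton] at hij hik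
        by_contra hne
        have : j = l := by tauto
        have : k = l := by tauto
        simp_all
    exact this ▸ hl
  · exact Or.inr hq

end Tet

/-! ### Gluings and vertex links -/

lemma Tet.perm_injective (σ : Equiv.Perm (Fin 4)) : Function.Injective (Tet.perm σ) :=
  Function.LeftInverse.injective (Tet.perm_inv_perm σ)

namespace PseudoTriangulation

variable {T : Type*} {τ : PseudoTriangulation T}

lemma char_glue {t u : T} {f : Fin 4} {σ : Equiv.Perm (Fin 4)} (h : τ.adj t f = some (u, σ))
    {x : Tet} (hx : x ∈ Tet.face f) : τ.char t x = τ.char u (Tet.perm σ x) :=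
  Quot.sound ⟨f, σ, h, hx, Tet.perm_apply σ x⟩

/-- Points of the tetrahedra that are identified in `M` share every property that is invariant
under the face gluings. -/
lemma iff_of_char_eq (P : T → Tet → Prop)
    (hP : ∀ t f u σ x, τ.adj t f = some (u, σ) → x ∈ Tet.face f → (P t x ↔ P u (Tet.perm σ x)))
    {t u : T} {x y : Tet} (h : τ.char t x = τ.char u y) : P t x ↔ P u y := by
  have hlift : ∀ p q, τ.Glue p q → P p.1 p.2 = P q.1 q.2 := by
    rintro ⟨t, x⟩ ⟨u, y⟩ ⟨f, σ, h1, h2, h3⟩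
    rw [Tet.perm_eq h3]
    exact propext (hP t f u σ x h1 h2)
  exact iff_of_eq (congrArg (Quot.lift (fun p : Σ _ : T, Tet => P p.1 p.2) hlift) h)

lemma cornerAt_iff {v : τ.Space} {t : T} {i : Fin 4} :
    τ.CornerAt v t i ↔ τ.char t (Tet.vertex i) = v := by
  constructor
  · rintro ⟨x, hx, rfl⟩
    rw [Tet.eq_vertex_of_apply_eq_one hx]
  · intro h
    exact ⟨Tet.vertex i, by simp [Tet.vertex], h⟩

lemma vertex_mem_face {i f : Fin 4} : Tet.vertex i ∈ Tet.face f ↔ i ≠ f := by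
  simp [Tet.face, Tet.vertex, Pi.single_apply, eq_comm]

lemma vertex_injective : Function.Injective Tet.vertex := by
  intro i j h
  have := congrArg (fun x : Tet => x.1 i) h
  by_contra hne
  simp [Tet.vertex, hne] at this

lemma cornerAt_glue {t u : T} {f : Fin 4} {σ : Equiv.Perm (Fin 4)} (h : τ.adj t f = some (u, σ))
    {i : Fin 4} (hi : i ≠ f) {v : τ.Space} : τ.CornerAt v t i ↔ τ.CornerAt v u (σ i) := by
  rw [cornerAt_iff, cornerAt_iff, char_glue h (vertex_mem_face.2 hi), Tet.perm_vertex]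

/-- The link of a vertex is connected: the corners at a vertex share every property that is
invariant under the face gluings. -/
lemma iff_of_cornerAt (Z : T → Fin 4 → Prop)
    (hZ : ∀ t f u σ i, τ.adj t f = some (u, σ) → i ≠ f → (Z t i ↔ Z u (σ i)))
    {v : τ.Space} {t u : T} {i j : Fin 4} (ht : τ.CornerAt v t i) (hu : τ.CornerAt v u j) :
    Z t i ↔ Z u j := by
  rw [cornerAt_iff] at ht hu
  have key := iff_of_char_eq (τ := τ) (fun t x => ∀ i, x = Tet.vertex i → Z t i) ?_
    (ht.trans hu.symm)
  · constructor
    · intro h; exact key.1 (fun k hk => by rwa [← vertex_injective hk]) j rfl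
    · intro h; exact key.2 (fun k hk => by rwa [← vertex_injective hk]) i rfl
  · intro t f u σ x h hx
    constructor
    · intro H i hi
      obtain ⟨j, rfl⟩ := σ.surjective i
      rw [← Tet.perm_vertex] at hi
      have hxj := Tet.perm_injective σ hi
      exact (hZ t f u σ j h (vertex_mem_face.1 (hxj ▸ hx))).1 (H j hxj)
    · rintro H i rfl
      exact (hZ t f u σ i h (vertex_mem_face.1 hx)).2 (H (σ i) (Tet.perm_vertex σ i))

lemma third_mem_face {i j f : Fin 4} (hij : i ≠ j) : Tet.third i j ∈ Tet.face f ↔ i ≠ f ∧ j ≠ f := by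
  constructor
  · intro h
    have h : (Tet.third i j).1 f = 0 := h
    constructor
    · rintro rfl; rw [Tet.third_left hij] at h; norm_num at h
    · rintro rfl; rw [Tet.third_right hij] at h; norm_num at h
  · rintro ⟨h1, h2⟩; exact Tet.third_other h1.symm h2.symm

lemma third_injective {i j k l : Fin 4} (hij : i ≠ j) (hkl : k ≠ l)
    (h : Tet.third i j = Tet.third k l) : i = k ∧ j = l := by
  have h1 : (Tet.third i j).1 k = 2 / 3 := by rw [h, Tet.third_left hkl]
  have h2 : (Tet.third i j).1 l = 1 / 3 := by rw [h, Tet.third_right hkl]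
  have hik : k = i := by
    by_contra hne
    by_cases hkj : k = j
    · rw [hkj, Tet.third_right hij] at h1; norm_num at h1
    · rw [Tet.third_other hne hkj] at h1; norm_num at h1
  have hjl : l = j := by
    by_contra hne
    rw [Tet.third_other (fun e => hkl (hik.trans e.symm)) hne] at h2; norm_num at h2
  exact ⟨hik.symm, hjl.symm⟩

variable (τ) in
/-- The vertex of the link of the corner `i` of `t` that lies on the edge from `i` to `j`. It stands
for the end at `i` of this edge. -/
noncomputable def germ (t : T) (i j : Fin 4) : τ.Space := τ.char t (Tet.third i j)

variable (τ) in
/-- The edge of the link of the corner `i` of `t` that lies in the face opposite to `f`. -/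
def linkEdge (t : T) (i f : Fin 4) : Set τ.Space :=
  τ.char t '' {x | x.1 i = 2 / 3 ∧ x ∈ Tet.face f}

lemma germ_glue {t u : T} {f : Fin 4} {σ : Equiv.Perm (Fin 4)} (h : τ.adj t f = some (u, σ))
    {i j : Fin 4} (hij : i ≠ j) (hi : i ≠ f) (hj : j ≠ f) :
    τ.germ t i j = τ.germ u (σ i) (σ j) := by
  rw [germ, char_glue h ((third_mem_face hij).2 ⟨hi, hj⟩), Tet.perm_third, germ]

lemma image_glue {t u : T} {f : Fin 4} {σ : Equiv.Perm (Fin 4)} (h : τ.adj t f = some (u, σ))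
    {S : Set Tet} (hS : S ⊆ Tet.face f) : τ.char t '' S = τ.char u '' (Tet.perm σ '' S) := by
  rw [Set.image_image]
  exact Set.image_congr fun x hx => char_glue h (hS hx)

lemma linkEdge_glue {t u : T} {f : Fin 4} {σ : Equiv.Perm (Fin 4)} (h : τ.adj t f = some (u, σ))
    (i : Fin 4) : τ.linkEdge t i f = τ.linkEdge u (σ i) (σ f) := by
  rw [linkEdge, image_glue h (fun x hx => hx.2), linkEdge]
  congr 1
  ext y
  constructor
  · rintro ⟨x, ⟨h1, h2⟩, rfl⟩
    exact ⟨by rw [Tet.perm_apply, h1], Tet.perm_mem_face.2 h2⟩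
  · rintro ⟨h1, h2⟩
    refine ⟨Tet.perm σ⁻¹ y, ⟨?_, ?_⟩, Tet.perm_perm_inv σ y⟩
    · rw [← h1, ← Tet.perm_apply σ⁻¹ y]; simp
    · rw [← Tet.perm_mem_face (σ := σ), Tet.perm_perm_inv]; exact h2

/-- The ends of the edges of the triangulation share every property that is invariant under the
face gluings. -/
lemma iff_of_germ_eq (Z : T → Fin 4 → Fin 4 → Prop)
    (hZ : ∀ t f u σ i j, τ.adj t f = some (u, σ) → i ≠ j → i ≠ f → j ≠ f →
      (Z t i j ↔ Z u (σ i) (σ j)))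
    {t u : T} {i j k l : Fin 4} (hij : i ≠ j) (hkl : k ≠ l) (h : τ.germ t i j = τ.germ u k l) :
    Z t i j ↔ Z u k l := by
  have key := iff_of_char_eq (τ := τ) (fun t x => ∀ i j, i ≠ j → x = Tet.third i j → Z t i j) ?_ h
  · constructor
    · intro H
      refine key.1 (fun a b hab he => ?_) k l hkl rfl
      obtain ⟨rfl, rfl⟩ := third_injective hij hab he
      exact H
    · intro H
      refine key.2 (fun a b hab he => ?_) i j hij rfl
      obtain ⟨rfl, rfl⟩ := third_injective hkl hab he
      exact H
  · intro t f u σ x h hx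
    constructor
    · intro H i j hij hi
      obtain ⟨k, rfl⟩ := σ.surjective i
      obtain ⟨l, rfl⟩ := σ.surjective j
      rw [← Tet.perm_third] at hi
      have hkl : k ≠ l := fun e => hij (by rw [e])
      have hxj := Tet.perm_injective σ hi
      obtain ⟨h1, h2⟩ := (third_mem_face (f := f) hkl).1 (hxj ▸ hx)
      exact (hZ t f u σ k l h hkl h1 h2).1 (H k l hkl hxj)
    · rintro H i j hij rfl
      obtain ⟨h1, h2⟩ := (third_mem_face (f := f) hij).1 hx
      exact (hZ t f u σ i j h hij h1 h2).2
        (H (σ i) (σ j) (by simpa using hij) (Tet.perm_third σ i j))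

/-- A point in the interior of a face of a tetrahedron is only identified with the corresponding
point of the face glued to it. -/
lemma eq_or_glued_of_char_eq {t u : T} {f : Fin 4} {x y : Tet} (hx : ∀ k, x.1 k = 0 ↔ k = f)
    (h : τ.char t x = τ.char u y) :
    (u = t ∧ y = x) ∨ ∃ σ, τ.adj t f = some (u, σ) ∧ y = Tet.perm σ x := by
  let P : T → Tet → Prop := fun u y =>
    (u = t ∧ y = x) ∨ ∃ σ, τ.adj t f = some (u, σ) ∧ y = Tet.perm σ x
  have hstep : ∀ t₁ g u₁ σ z, τ.adj t₁ g = some (u₁, σ) → z ∈ Tet.face g → P t₁ z →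
      P u₁ (Tet.perm σ z) := by
    rintro t₁ g u₁ σ z h1 hz (⟨rfl, rfl⟩ | ⟨ρ, hρ, rfl⟩)
    · rw [(hx g).1 hz] at h1
      exact Or.inr ⟨σ, h1, rfl⟩
    · obtain ⟨k, rfl⟩ := ρ.surjective g
      rw [Tet.perm_mem_face] at hz
      have hz := (hx k).1 hz
      subst hz
      have := τ.adj_symm hρ
      rw [this] at h1
      obtain ⟨rfl, rfl⟩ := Prod.mk.inj (Option.some.inj h1)
      exact Or.inl ⟨rfl, Tet.perm_inv_perm _ _⟩
  refine (iff_of_char_eq P ?_ h).1 (Or.inl ⟨rfl, rfl⟩)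
  intro t₁ g u₁ σ z h1 hz
  refine ⟨hstep t₁ g u₁ σ z h1 hz, fun hP => ?_⟩
  have := hstep u₁ (σ g) t₁ σ⁻¹ _ (τ.adj_symm h1) (Tet.perm_mem_face.2 hz) hP
  rwa [Tet.perm_inv_perm] at this

/-- Edges of links agree only if they come from the same face or from two faces that are glued. -/
lemma eq_or_glued_of_linkEdge_eq {t u : T} {i f j g : Fin 4} (hif : i ≠ f)
    (h : τ.linkEdge t i f = τ.linkEdge u j g) :
    (u = t ∧ j = i ∧ g = f) ∨ ∃ σ, τ.adj t f = some (u, σ) ∧ j = σ i ∧ g = σ f := by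
  let x : Tet := ⟨fun k => if k = f then 0 else if k = i then 2 / 3 else 1 / 6,
    fun k => by dsimp only; split_ifs <;> norm_num, by
      rw [Fin.sum_univ_four]
      fin_cases i <;> fin_cases f <;> simp at hif ⊢
      all_goals norm_num⟩
  have hxf : ∀ k, x.1 k = 0 ↔ k = f := by
    intro k
    by_cases hk : k = f
    · simp [x, hk]
    · by_cases hki : k = i <;> simp [x, hk, hki]
  have hxi : ∀ k, x.1 k = 2 / 3 → k = i := by
    intro k hk
    by_contra hki
    by_cases hkf : k = f
    · rw [(hxf k).2 hkf] at hk; norm_num at hk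
    · simp only [x, hkf, hki, if_false] at hk; norm_num at hk
  have hx : τ.char t x ∈ τ.linkEdge t i f :=
    ⟨x, ⟨by simp [x, hif], (hxf f).2 rfl⟩, rfl⟩
  rw [h] at hx
  obtain ⟨y, ⟨hy1, hy2⟩, hy⟩ := hx
  rcases eq_or_glued_of_char_eq hxf hy.symm with ⟨rfl, rfl⟩ | ⟨σ, hσ, rfl⟩
  · exact Or.inl ⟨rfl, hxi j hy1, (hxf g).1 hy2⟩
  · right
    obtain ⟨k, rfl⟩ := σ.surjective j
    obtain ⟨l, rfl⟩ := σ.surjective g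
    rw [Tet.perm_apply] at hy1
    rw [Tet.perm_mem_face] at hy2
    exact ⟨σ, hσ, by rw [hxi k hy1], by rw [(hxf l).1 hy2]⟩

lemma linkVertices_eq (v : τ.Space) :
    τ.linkVertices v = {p | ∃ t i j, i ≠ j ∧ τ.CornerAt v t i ∧ p = τ.germ t i j} := by
  ext p; constructor
  · rintro ⟨t, i, j, x, hij, hc, h1, h2, rfl⟩
    exact ⟨t, i, j, hij, hc, by rw [Tet.eq_third hij h1 h2, germ]⟩
  · rintro ⟨t, i, j, hij, hc, rfl⟩
    exact ⟨t, i, j, _, hij, hc, Tet.third_left hij, Tet.third_right hij, rfl⟩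

lemma linkEdges_eq (v : τ.Space) :
    τ.linkEdges v = {a | ∃ t i f, i ≠ f ∧ τ.CornerAt v t i ∧ a = τ.linkEdge t i f} := rfl

lemma finite_linkVertices [Finite T] (v : τ.Space) : (τ.linkVertices v).Finite := by
  rw [linkVertices_eq]
  refine (Set.finite_range fun s : T × Fin 4 × Fin 4 => τ.germ s.1 s.2.1 s.2.2).subset ?_
  rintro _ ⟨t, i, j, -, -, rfl⟩
  exact ⟨(t, i, j), rfl⟩

lemma finite_linkEdges [Finite T] (v : τ.Space) : (τ.linkEdges v).Finite := by
  rw [linkEdges_eq]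
  refine (Set.finite_range fun s : T × Fin 4 × Fin 4 => τ.linkEdge s.1 s.2.1 s.2.2).subset ?_
  rintro _ ⟨t, i, j, -, -, rfl⟩
  exact ⟨(t, i, j), rfl⟩

end PseudoTriangulation

/-! ### The Euler characteristic of a part of a vertex link -/

/-- Two injective linear maps into `K^E` with orthogonal images. -/
lemma card_add_card_le_of_orthogonal {K E Y V : Type*} [Field K] [Fintype E] [Fintype Y] [Fintype V]
    (f : (Y → K) →ₗ[K] E → K) (g : (V → K) →ₗ[K] E → K) (hf : Function.Injective f)
    (hg : Function.Injective g) (h : ∀ y v, ∑ e, f y e * g v e = 0) :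
    Fintype.card Y + Fintype.card V ≤ Fintype.card E := by
  classical
  have hmul : (LinearMap.toMatrix' g).transpose * LinearMap.toMatrix' f = 0 := by
    ext v y
    simp only [Matrix.mul_apply, Matrix.transpose_apply, LinearMap.toMatrix'_apply,
      Matrix.zero_apply]
    rw [← h (Pi.single y 1) (Pi.single v 1)]
    exact Finset.sum_congr rfl fun e _ => mul_comm _ _
  have := Matrix.rank_add_rank_le_card_of_mul_eq_zero hmul
  rw [Matrix.rank_transpose] at this
  have h1 : (LinearMap.toMatrix' f).rank = Fintype.card Y := by
    rw [Matrix.rank, ← Matrix.toLin'_apply', Matrix.toLin'_toMatrix',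
      LinearMap.finrank_range_of_inj hf, Module.finrank_fintype_fun_eq_card]
  have h2 : (LinearMap.toMatrix' g).rank = Fintype.card V := by
    rw [Matrix.rank, ← Matrix.toLin'_apply', Matrix.toLin'_toMatrix',
      LinearMap.finrank_range_of_inj hg, Module.finrank_fintype_fun_eq_card]
  omega

namespace PseudoTriangulation

variable {T : Type*} {τ : PseudoTriangulation T}

open Classical in
variable (τ) in
/-- The boundary modulo 2 of a 2-chain of the union of all links. -/
noncomputable def boundaryMap [Fintype T] :
    (T × Fin 4 → ZMod 2) →ₗ[ZMod 2] (Set τ.Space → ZMod 2) where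
  toFun Z ε := ∑ s : T × Fin 4 × Fin 4 with s.2.1 ≠ s.2.2 ∧ τ.linkEdge s.1 s.2.1 s.2.2 = ε,
    Z (s.1, s.2.1)
  map_add' Z W := by ext ε; simp [Finset.sum_add_distrib]
  map_smul' c Z := by ext ε; simp [Finset.mul_sum]

variable (τ) in
/-- The sum of the values of a 0-cochain at the two ends of the link edge in the face of `t`
opposite to `f`, near `i`. -/
noncomputable def endSum (t : T) (i f : Fin 4) : (τ.Space → ZMod 2) →ₗ[ZMod 2] ZMod 2 :=
  ∑ j with j ≠ i ∧ j ≠ f, LinearMap.proj (τ.germ t i j)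

lemma endSum_apply (t : T) (i f : Fin 4) (φ : τ.Space → ZMod 2) :
    τ.endSum t i f φ = ∑ j with j ≠ i ∧ j ≠ f, φ (τ.germ t i j) := by
  simp [endSum]

lemma endSum_congr {t u : T} {i f j g : Fin 4} (hif : i ≠ f)
    (h : τ.linkEdge t i f = τ.linkEdge u j g) : τ.endSum t i f = τ.endSum u j g := by
  rcases eq_or_glued_of_linkEdge_eq hif h with ⟨rfl, rfl, rfl⟩ | ⟨σ, hσ, rfl, rfl⟩
  · rfl
  · ext1 φ
    rw [endSum_apply, endSum_apply]
    refine Finset.sum_equiv σ (by simp) fun k hk => ?_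
    simp only [Finset.mem_filter, Finset.mem_univ, true_and] at hk
    rw [germ_glue hσ hk.1.symm hif hk.2]

open Classical in
variable (τ) in
/-- The coboundary modulo 2 of a 0-cochain of the union of all links. -/
noncomputable def coboundaryMap : (τ.Space → ZMod 2) →ₗ[ZMod 2] (Set τ.Space → ZMod 2) :=
  LinearMap.pi fun ε =>
    if h : ∃ s : T × Fin 4 × Fin 4, s.2.1 ≠ s.2.2 ∧ τ.linkEdge s.1 s.2.1 s.2.2 = ε then
      τ.endSum h.choose.1 h.choose.2.1 h.choose.2.2
    else 0

lemma coboundaryMap_linkEdge (φ : τ.Space → ZMod 2) (t : T) {i f : Fin 4} (hif : i ≠ f) :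
    τ.coboundaryMap φ (τ.linkEdge t i f) = ∑ j with j ≠ i ∧ j ≠ f, φ (τ.germ t i j) := by
  have h : ∃ s : T × Fin 4 × Fin 4, s.2.1 ≠ s.2.2 ∧
      τ.linkEdge s.1 s.2.1 s.2.2 = τ.linkEdge t i f := ⟨(t, i, f), hif, rfl⟩
  rw [coboundaryMap, LinearMap.pi_apply, dif_pos h,
    endSum_congr h.choose_spec.1 h.choose_spec.2, endSum_apply]

/-- The boundary of a triangle has no boundary modulo 2, in dual form. -/
lemma sum_boundaryMap_mul_coboundaryMap [Fintype T] (Z : T × Fin 4 → ZMod 2)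
    (φ : τ.Space → ZMod 2) {S : Finset (Set τ.Space)}
    (hS : ∀ t i f, i ≠ f → τ.boundaryMap Z (τ.linkEdge t i f) ≠ 0 →
      τ.coboundaryMap φ (τ.linkEdge t i f) ≠ 0 → τ.linkEdge t i f ∈ S) :
    ∑ ε ∈ S, τ.boundaryMap Z ε * τ.coboundaryMap φ ε = 0 := by
  classical
  let slots : Finset (T × Fin 4 × Fin 4) := Finset.univ.filter fun s => s.2.1 ≠ s.2.2
  let edge : T × Fin 4 × Fin 4 → Set τ.Space := fun s => τ.linkEdge s.1 s.2.1 s.2.2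
  have hsum : ∑ ε ∈ S, τ.boundaryMap Z ε * τ.coboundaryMap φ ε =
      ∑ ε ∈ S ∪ slots.image edge, τ.boundaryMap Z ε * τ.coboundaryMap φ ε := by
    refine Finset.sum_subset Finset.subset_union_left fun ε hε hεS => ?_
    obtain ⟨s, hs, rfl⟩ := Finset.mem_image.1 ((Finset.mem_union.1 hε).resolve_left hεS)
    by_contra hne
    exact hεS (hS _ _ _ (Finset.mem_filter.1 hs).2 (left_ne_zero_of_mul hne)
      (right_ne_zero_of_mul hne))
  have hfib : ∑ ε ∈ S ∪ slots.image edge, τ.boundaryMap Z ε * τ.coboundaryMap φ ε =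
      ∑ s ∈ slots, Z (s.1, s.2.1) * τ.coboundaryMap φ (edge s) := by
    rw [← Finset.sum_fiberwise_of_maps_to (g := edge) (t := S ∪ slots.image edge)
      (fun s hs => Finset.mem_union_right _ (Finset.mem_image_of_mem edge hs))]
    refine Finset.sum_congr rfl fun ε _ => ?_
    have : τ.boundaryMap Z ε = ∑ s ∈ slots with edge s = ε, Z (s.1, s.2.1) := by
      rw [Finset.filter_filter]; rfl
    rw [this, Finset.sum_mul]
    refine Finset.sum_congr rfl fun s hs => ?_
    rw [(Finset.mem_filter.1 hs).2]
  have hcorner : ∀ t i, ∑ f with i ≠ f, ∑ j with j ≠ i ∧ j ≠ f, φ (τ.germ t i j) = 0 := by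
    intro t i
    have h2 : ∀ x : ZMod 2, x + x = 0 := by decide
    simp only [Finset.sum_filter, Fin.sum_univ_four]
    generalize φ (τ.germ t i 0) = a, φ (τ.germ t i 1) = b, φ (τ.germ t i 2) = c,
      φ (τ.germ t i 3) = d
    clear hS hsum hfib
    revert a b c d i
    decide
  rw [hsum, hfib]
  have : ∑ s ∈ slots, Z (s.1, s.2.1) * τ.coboundaryMap φ (edge s) =
      ∑ t, ∑ i, Z (t, i) * ∑ f with i ≠ f, ∑ j with j ≠ i ∧ j ≠ f, φ (τ.germ t i j) := by
    rw [Finset.sum_filter, Fintype.sum_prod_type]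
    refine Finset.sum_congr rfl fun t _ => ?_
    rw [Fintype.sum_prod_type]
    refine Finset.sum_congr rfl fun i _ => ?_
    rw [Finset.mul_sum, Finset.sum_filter]
    refine Finset.sum_congr rfl fun f _ => ?_
    split_ifs with hif
    · rw [coboundaryMap_linkEdge φ t hif]
    · rfl
  rw [this]
  simp [hcorner]

lemma boundaryMap_linkEdge [Fintype T] (Z : T × Fin 4 → ZMod 2) {t u : T} {i f : Fin 4}
    {σ : Equiv.Perm (Fin 4)} (h : τ.adj t f = some (u, σ)) (hif : i ≠ f) :
    τ.boundaryMap Z (τ.linkEdge t i f) = Z (t, i) + Z (u, σ i) := by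
  classical
  have hset : (Finset.univ.filter fun s : T × Fin 4 × Fin 4 => s.2.1 ≠ s.2.2 ∧
      τ.linkEdge s.1 s.2.1 s.2.2 = τ.linkEdge t i f) = {(t, i, f), (u, σ i, σ f)} := by
    ext ⟨w, j, g⟩
    simp only [Finset.mem_filter, Finset.mem_univ, true_and, Finset.mem_insert,
      Finset.mem_singleton, Prod.mk.injEq]
    constructor
    · rintro ⟨h1, h2⟩
      rcases eq_or_glued_of_linkEdge_eq hif h2.symm with ⟨rfl, rfl, rfl⟩ | ⟨ρ, hρ, rfl, rfl⟩
      · simp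
      · rw [h] at hρ
        obtain ⟨rfl, rfl⟩ := Prod.mk.inj (Option.some.inj hρ)
        simp
    · rintro (⟨rfl, rfl, rfl⟩ | ⟨rfl, rfl, rfl⟩)
      · exact ⟨hif, rfl⟩
      · exact ⟨by simpa using hif, (linkEdge_glue h i).symm⟩
  have hne : (t, i, f) ≠ (u, σ i, σ f) := by
    intro he
    simp only [Prod.mk.injEq] at he
    exact τ.adj_ne h (Prod.ext he.1.symm he.2.2.symm)
  show ∑ s : T × Fin 4 × Fin 4 with _, Z (s.1, s.2.1) = _
  rw [show (Finset.univ.filter fun s : T × Fin 4 × Fin 4 => s.2.1 ≠ s.2.2 ∧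
      τ.linkEdge s.1 s.2.1 s.2.2 = τ.linkEdge t i f) = {(t, i, f), (u, σ i, σ f)} from hset,
    Finset.sum_pair hne]

variable (τ) in
/-- The vertices of links that lie on the triangles at the corners in `X`. -/
def verticesOf (X : Set (T × Fin 4)) : Set τ.Space :=
  {p | ∃ c ∈ X, ∃ j, c.2 ≠ j ∧ p = τ.germ c.1 c.2 j}

variable (τ) in
/-- The edges of the link of `v` all of whose adjacent triangles are at corners in `X`. -/
def innerEdges (v : τ.Space) (X : Set (T × Fin 4)) : Set (Set τ.Space) :=
  {ε ∈ τ.linkEdges v | ∀ t i f, i ≠ f → ε = τ.linkEdge t i f → (t, i) ∈ X}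

/-- Let `X` be a nonempty set of triangles of the link of `v`, and `R` a set of at most one edge of
`X`, which is not a loop. The triangles not in `X` and the vertices not on `X` are together at most
as many as the edges not in `R` that have an adjacent triangle outside `X`: modulo 2, boundary and
coboundary embed the functions on the former and on the latter into the functions on these edges,
as the link is connected, and the images are orthogonal. -/
lemma ncard_add_ncard_le_of_link [Fintype T] (v : τ.Space) {X : Set (T × Fin 4)}
    (hX : X ⊆ τ.linkTriangles v) (hne : X.Nonempty) {R : Set (Set τ.Space)}
    (hRs : R.Subsingleton)
    (hRX : ∀ ε ∈ R, ∃ t i f, i ≠ f ∧ (t, i) ∈ X ∧ ε = τ.linkEdge t i f)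
    (hRφ : ∀ ε ∈ R, ∃ φ, τ.coboundaryMap φ ε ≠ 0) :
    (τ.linkTriangles v \ X).ncard + (τ.linkVertices v \ τ.verticesOf X).ncard ≤
      ((τ.linkEdges v \ τ.innerEdges v X) \ R).ncard := by
  classical
  set Y := τ.linkTriangles v \ X with hY
  set V := τ.linkVertices v \ τ.verticesOf X with hV
  set E := (τ.linkEdges v \ τ.innerEdges v X) \ R with hE
  have : Fintype Y := Fintype.ofFinite Y
  have : Fintype V := ((τ.finite_linkVertices v).subset Set.sdiff_subset).fintype
  have : Fintype E := ((τ.finite_linkEdges v).subset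
    (Set.sdiff_subset.trans Set.sdiff_subset)).fintype
  obtain ⟨c₀, hc₀⟩ := hne
  let extY := Function.ExtendByZero.linearMap (ZMod 2) (Subtype.val : Y → T × Fin 4)
  let extV := Function.ExtendByZero.linearMap (ZMod 2) (Subtype.val : V → τ.Space)
  have extY_mem : ∀ z (c : Y), extY z c.1 = z c := fun z c =>
    Subtype.val_injective.extend_apply z 0 c
  have extY_notMem : ∀ z c, c ∉ Y → extY z c = 0 := fun z c hc =>
    Function.extend_apply' z (0 : T × Fin 4 → ZMod 2) c (by rintro ⟨a, ha⟩; exact hc (ha ▸ a.2))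
  have extV_mem : ∀ z (c : V), extV z c.1 = z c := fun z c =>
    Subtype.val_injective.extend_apply z 0 c
  have extV_notMem : ∀ z c, c ∉ V → extV z c = 0 := fun z c hc =>
    Function.extend_apply' z (0 : τ.Space → ZMod 2) c (by rintro ⟨a, ha⟩; exact hc (ha ▸ a.2))
  have extV_X : ∀ φ t i j, (t, i) ∈ X → i ≠ j → extV φ (τ.germ t i j) = 0 := by
    intro φ t i j hc hij
    exact extV_notMem φ _ fun h => h.2 ⟨(t, i), hc, j, hij, rfl⟩
  let f : (Y → ZMod 2) →ₗ[ZMod 2] E → ZMod 2 :=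
    LinearMap.funLeft _ _ Subtype.val ∘ₗ τ.boundaryMap ∘ₗ extY
  let g : (V → ZMod 2) →ₗ[ZMod 2] E → ZMod 2 :=
    LinearMap.funLeft _ _ Subtype.val ∘ₗ τ.coboundaryMap ∘ₗ extV
  have hf_apply : ∀ z (e : E), f z e = τ.boundaryMap (extY z) e.1 := fun _ _ => rfl
  have hg_apply : ∀ φ (e : E), g φ e = τ.coboundaryMap (extV φ) e.1 := fun _ _ => rfl
  -- A boundary is supported on the edges with an adjacent triangle in `Y`.
  have hbdry : ∀ z t i f, i ≠ f → τ.boundaryMap (extY z) (τ.linkEdge t i f) ≠ 0 →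
      τ.linkEdge t i f ∈ τ.linkEdges v \ τ.innerEdges v X := by
    intro z t i f hif hne0
    obtain ⟨s, hs, hs0⟩ := Finset.exists_ne_zero_of_sum_ne_zero hne0
    simp only [Finset.mem_filter, Finset.mem_univ, true_and] at hs
    have hsY : (s.1, s.2.1) ∈ Y := by
      by_contra hc; exact hs0 (extY_notMem z _ hc)
    refine ⟨⟨s.1, s.2.1, s.2.2, hs.1, hsY.1, hs.2.symm⟩, fun h => hsY.2 ?_⟩
    exact h.2 _ _ _ hs.1 hs.2.symm
  have hcob_R : ∀ φ, ∀ ε ∈ R, τ.coboundaryMap (extV φ) ε = 0 := by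
    intro φ ε hε
    obtain ⟨t, i, f, hif, hc, rfl⟩ := hRX ε hε
    rw [coboundaryMap_linkEdge _ _ hif]
    refine Finset.sum_eq_zero fun j hj => extV_X φ t i j hc ?_
    simp only [Finset.mem_filter, Finset.mem_univ, true_and] at hj
    exact hj.1.symm
  have horth : ∀ z φ, ∑ e, f z e * g φ e = 0 := by
    intro z φ
    have := sum_boundaryMap_mul_coboundaryMap (τ := τ) (extY z) (extV φ) (S := E.toFinset) ?_
    · rw [← this]
      exact (Finset.sum_subtype E.toFinset (fun ε => Set.mem_toFinset)
        fun ε => τ.boundaryMap (extY z) ε * τ.coboundaryMap (extV φ) ε).symm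
    · intro t i f hif h1 h2
      rw [Set.mem_toFinset]
      exact ⟨hbdry z t i f hif h1, fun hR => h2 (hcob_R φ _ hR)⟩
  have hf : Function.Injective f := by
    rw [← LinearMap.ker_eq_bot, LinearMap.ker_eq_bot']
    intro z hz
    have hnotR : ∀ t i f, i ≠ f → τ.linkEdge t i f ∉ R →
        τ.boundaryMap (extY z) (τ.linkEdge t i f) = 0 := by
      intro t i f hif hR
      by_contra h0
      exact h0 (congrFun hz ⟨_, hbdry z t i f hif h0, hR⟩)
    -- The boundary vanishes on the edge in `R` too, as it is a cycle and this edge is not a loop.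
    have hall : ∀ t i f, i ≠ f → τ.boundaryMap (extY z) (τ.linkEdge t i f) = 0 := by
      intro t i f hif
      by_cases hR : τ.linkEdge t i f ∈ R
      · obtain ⟨φ, hφ⟩ := hRφ _ hR
        have := sum_boundaryMap_mul_coboundaryMap (τ := τ) (extY z) φ
          (S := {τ.linkEdge t i f}) ?_
        · rw [Finset.sum_singleton] at this
          exact (mul_eq_zero.1 this).resolve_right hφ
        · intro t' i' f' hif' h1 _
          rw [Finset.mem_singleton]
          by_contra hne
          exact h1 (hnotR t' i' f' hif' fun h => hne (hRs h hR))
      · exact hnotR t i f hif hR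
    have hconst : ∀ c ∈ τ.linkTriangles v, extY z c = 0 := by
      intro c hc
      refine (iff_of_cornerAt (fun t i => extY z (t, i) = 0) ?_ (hX hc₀) hc).1
        (extY_notMem z _ fun h => h.2 hc₀)
      intro t f u σ i h hif
      have := hall t i f hif
      rw [boundaryMap_linkEdge _ h hif] at this
      rw [eq_neg_of_add_eq_zero_left this, neg_eq_zero]
    ext c
    rw [← extY_mem z c, hconst c.1 c.2.1]; rfl
  have hg : Function.Injective g := by
    rw [← LinearMap.ker_eq_bot, LinearMap.ker_eq_bot']
    intro φ hφ
    have hall : ∀ t i f, τ.CornerAt v t i → i ≠ f →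
        ∑ j with j ≠ i ∧ j ≠ f, extV φ (τ.germ t i j) = 0 := by
      intro t i f hc hif
      rw [← coboundaryMap_linkEdge _ _ hif]
      by_cases hR : τ.linkEdge t i f ∈ R
      · exact hcob_R φ _ hR
      by_cases hin : τ.linkEdge t i f ∈ τ.innerEdges v X
      · rw [coboundaryMap_linkEdge _ _ hif]
        refine Finset.sum_eq_zero fun j hj => extV_X φ t i j (hin.2 t i f hif rfl) ?_
        simp only [Finset.mem_filter, Finset.mem_univ, true_and] at hj
        exact hj.1.symm
      · exact congrFun hφ ⟨_, ⟨⟨t, i, f, hif, hc, rfl⟩, hin⟩, hR⟩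
    -- So the values at the vertices of each triangle of the link agree.
    have heq : ∀ t i j k, τ.CornerAt v t i → i ≠ j → i ≠ k →
        extV φ (τ.germ t i j) = extV φ (τ.germ t i k) := by
      intro t i j k hc hij hik
      by_cases hjk : j = k
      · rw [hjk]
      obtain ⟨f, hf⟩ : ∃ f, i ≠ f ∧ (Finset.univ.filter fun l => l ≠ i ∧ l ≠ f) = {j, k} := by
        clear hφ hall hc
        revert i j k; decide
      have := hall t i f hc hf.1
      rw [hf.2, Finset.sum_pair hjk] at this
      rw [eq_neg_of_add_eq_zero_left this, ZMod.neg_eq_self_mod_two]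
    have hconst : ∀ c ∈ τ.linkTriangles v, ∀ j, c.2 ≠ j → extV φ (τ.germ c.1 c.2 j) = 0 := by
      intro c hc
      refine ((iff_of_cornerAt (fun t i => τ.CornerAt v t i → ∀ j, i ≠ j →
        extV φ (τ.germ t i j) = 0) ?_ (hX hc₀) hc).1 fun _ j hj => extV_X φ _ _ j hc₀ hj) hc
      intro t f u σ i h hif
      obtain ⟨k, hki, hkf⟩ : ∃ k, i ≠ k ∧ k ≠ f := by clear h; revert i f; decide
      rw [← cornerAt_glue h hif]
      refine forall_congr' fun hc => ?_
      have hc' := (cornerAt_glue h hif).1 hc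
      constructor
      · intro H j hj
        rw [heq u (σ i) j (σ k) hc' hj (by simpa using hki), ← germ_glue h hki hif hkf]
        exact H k hki
      · intro H j hj
        rw [heq t i j k hc hj hki, germ_glue h hki hif hkf]
        exact H _ (by simpa using hki)
    ext p
    rw [← extV_mem φ p]
    have hp := p.2.1
    rw [linkVertices_eq] at hp
    obtain ⟨t, i, j, hij, hc, hpe⟩ := hp
    rw [hpe, hconst (t, i) hc j hij]; rfl
  have := card_add_card_le_of_orthogonal f g hf hg horth
  rwa [← Nat.card_eq_fintype_card, ← Nat.card_eq_fintype_card, ← Nat.card_eq_fintype_card] at this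

lemma verticesOf_subset {v : τ.Space} {X : Set (T × Fin 4)} (hX : X ⊆ τ.linkTriangles v) :
    τ.verticesOf X ⊆ τ.linkVertices v := by
  rw [linkVertices_eq]
  rintro p ⟨c, hc, j, hj, rfl⟩
  exact ⟨c.1, c.2, j, hj, hX hc, rfl⟩

/-- The Euler characteristic of the link of `v` is at most that of the union of the vertices and
triangles of `X` and of the edges that are adjacent to no other triangle. -/
theorem linkEulerChar_le [Fintype T] (v : τ.Space) {X : Set (T × Fin 4)}
    (hX : X ⊆ τ.linkTriangles v) (hne : X.Nonempty) :
    τ.linkEulerChar v ≤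
      ((τ.verticesOf X).ncard : ℤ) - (τ.innerEdges v X).ncard + X.ncard := by
  have h := ncard_add_ncard_le_of_link v hX hne (R := ∅) Set.subsingleton_empty (by simp) (by simp)
  rw [Set.sdiff_empty] at h
  have h1 := Set.ncard_sdiff_add_ncard_of_subset hX (Set.toFinite _)
  have h2 := Set.ncard_sdiff_add_ncard_of_subset (verticesOf_subset hX) (finite_linkVertices v)
  have h3 := Set.ncard_sdiff_add_ncard_of_subset
    (show τ.innerEdges v X ⊆ τ.linkEdges v from fun _ h => h.1) (finite_linkEdges v)
  rw [linkEulerChar]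
  omega

/-- If the link of `v` has an edge between a triangle of `X` and another one that is not a loop,
the inequality of `linkEulerChar_le` is strict. -/
theorem linkEulerChar_lt [Fintype T] (v : τ.Space) {X : Set (T × Fin 4)}
    (hX : X ⊆ τ.linkTriangles v) {t u : T} {i f j k : Fin 4} {σ : Equiv.Perm (Fin 4)}
    (h : τ.adj t f = some (u, σ)) (hif : i ≠ f) (htX : (t, i) ∈ X) (huX : (u, σ i) ∉ X)
    (hends : (Finset.univ.filter fun l => l ≠ i ∧ l ≠ f) = {j, k}) (hjk : j ≠ k)
    (hloop : τ.germ t i j ≠ τ.germ t i k) :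
    τ.linkEulerChar v <
      ((τ.verticesOf X).ncard : ℤ) - (τ.innerEdges v X).ncard + X.ncard := by
  classical
  have hkey := ncard_add_ncard_le_of_link v hX ⟨_, htX⟩ (R := {τ.linkEdge t i f})
    Set.subsingleton_singleton
    (by rintro ε rfl; exact ⟨t, i, f, hif, htX, rfl⟩)
    (by
      rintro ε rfl
      refine ⟨Pi.single (τ.germ t i j) 1, ?_⟩
      rw [coboundaryMap_linkEdge _ _ hif, hends, Finset.sum_pair hjk]
      simp [hloop.symm])
  have h0 := Set.ncard_sdiff_singleton_add_one
    (show τ.linkEdge t i f ∈ τ.linkEdges v \ τ.innerEdges v X from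
      ⟨⟨t, i, f, hif, hX htX, rfl⟩, fun hin =>
        huX (hin.2 u (σ i) (σ f) (by simpa using hif) (linkEdge_glue h i))⟩)
    ((finite_linkEdges v).subset Set.sdiff_subset)
  have h1 := Set.ncard_sdiff_add_ncard_of_subset hX (Set.toFinite _)
  have h2 := Set.ncard_sdiff_add_ncard_of_subset (verticesOf_subset hX) (finite_linkVertices v)
  have h3 := Set.ncard_sdiff_add_ncard_of_subset
    (show τ.innerEdges v X ⊆ τ.linkEdges v from fun _ h => h.1) (finite_linkEdges v)
  rw [linkEulerChar]
  omega

end PseudoTriangulation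

/-! ### Levels of the discs of a normal surface -/

namespace Tet

lemma IsNormalDisc.point_unique {A : Finset (Fin 4)} {D : Set Tet} (h : IsNormalDisc A D)
    {i j : Fin 4} {p q : Tet} (hp : p ∈ D) (hp' : p ∈ edge i j) (hq : q ∈ D)
    (hq' : q ∈ edge i j) : p = q := by
  have hsep := h.separates_of_mem_edge hp hp'
  by_cases hi : i ∈ A
  · exact h.eq_of_mem_edge hi (by tauto) hp hp' hq hq'
  · rw [edge_comm] at hp' hq'
    exact h.eq_of_mem_edge (i := j) (j := i) (by tauto) hi hp hp' hq hq'

lemma IsNormalDisc.ne_of_mem_edge {A : Finset (Fin 4)} {D : Set Tet} (h : IsNormalDisc A D)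
    {i j : Fin 4} {p : Tet} (hp : p ∈ D) (hp' : p ∈ edge i j) : i ≠ j := by
  rintro rfl
  exact h.separates_of_mem_edge hp hp' Iff.rfl

lemma IsNormalDisc.apply_ne_zero {A : Finset (Fin 4)} {D : Set Tet} (h : IsNormalDisc A D)
    {i j : Fin 4} {p : Tet} (hp : p ∈ D) (hp' : p ∈ edge i j) : p.1 i ≠ 0 := by
  intro h0
  refine h.notMem_of_mem_edge (i := j) (j := j) Iff.rfl (fun k hk _ => ?_) hp
  by_cases hki : k = i
  · rw [hki, h0]
  · exact hp' k hki hk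

/-- A disc meets an edge in an interior point of it, which lies on no other edge. -/
lemma IsNormalDisc.edge_unique {A : Finset (Fin 4)} {D : Set Tet} (h : IsNormalDisc A D)
    {i j k l : Fin 4} {p : Tet} (hp : p ∈ D) (hij : p ∈ edge i j) (hkl : p ∈ edge k l) :
    (k = i ∧ l = j) ∨ (k = j ∧ l = i) := by
  have hk := h.apply_ne_zero hp hkl
  have hl := h.apply_ne_zero hp (edge_comm k l ▸ hkl)
  have hne := h.ne_of_mem_edge hp hkl
  have h1 : k = i ∨ k = j := by
    by_contra hcon; push Not at hcon; exact hk (hij k hcon.1 hcon.2)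
  have h2 : l = i ∨ l = j := by
    by_contra hcon; push Not at hcon; exact hl (hij l hcon.1 hcon.2)
  rcases h1 with rfl | rfl <;> rcases h2 with rfl | rfl <;> simp_all

lemma IsNormalTriangle.exists_mem_edge {i : Fin 4} {D : Set Tet} (h : IsNormalTriangle i D)
    {j : Fin 4} (hij : i ≠ j) : ∃ p, p ∈ D ∧ p ∈ edge i j :=
  IsNormalDisc.exists_mem_edge h (by simp) (by simpa using hij.symm)

lemma IsNormalTriangle.inter_face_nonempty {i f : Fin 4} {D : Set Tet}
    (h : IsNormalTriangle i D) : (D ∩ face f).Nonempty ↔ i ≠ f := by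
  constructor
  · intro hf
    obtain ⟨k, hk, -, -, hkf, -⟩ := h.exists_separated_of_inter_face hf
    rwa [Finset.mem_singleton.1 hk] at hkf
  · intro hif
    obtain ⟨j, hij, hjf⟩ : ∃ j, i ≠ j ∧ j ≠ f := by clear h; revert i f; decide
    obtain ⟨p, hp, hpe⟩ := h.exists_mem_edge hij
    exact ⟨p, hp, edge_subset_face hif hjf hpe⟩

end Tet

namespace NormalSurface

open PseudoTriangulation

variable {T : Type*} {τ : PseudoTriangulation T} (F : NormalSurface τ)

lemma mem_carrier_iff {t : T} {x : Tet} : τ.char t x ∈ F.carrier ↔ ∃ D ∈ F.discs t, x ∈ D := by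
  have : x ∈ ⋃₀ F.discs t ↔ τ.char t x ∈ F.carrier := by rw [F.sUnion_discs]; rfl
  rw [← this]; rfl

variable {F} in
lemma disc_unique {t : T} {D E : Set Tet} (hD : D ∈ F.discs t) (hE : E ∈ F.discs t) {x : Tet}
    (hxD : x ∈ D) (hxE : x ∈ E) : D = E := by
  by_contra hne
  exact Set.disjoint_left.1 (F.discs_disjoint t hD hE hne) hxD hxE

/-- The points of `F` on the edge `ij` of `t` that are nearer to `i` than `x`. -/
def nearer (t : T) (i j : Fin 4) (x : Tet) : Set Tet :=
  {y | y ∈ Tet.edge i j ∧ τ.char t y ∈ F.carrier ∧ x.1 i < y.1 i}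

/-- The number of points of `F` on the edge `ij` of `t` that are nearer to `i` than `x`. -/
noncomputable def level (t : T) (i j : Fin 4) (x : Tet) : ℕ := (F.nearer t i j x).ncard

lemma finite_edge (t : T) (i j : Fin 4) :
    {y | y ∈ Tet.edge i j ∧ τ.char t y ∈ F.carrier}.Finite := by
  refine ((F.discs_finite t).biUnion (t := fun D => D ∩ Tet.edge i j) fun D hD => ?_).subset ?_
  · obtain ⟨A, hA⟩ := F.discs_normal t D hD
    exact Set.Subsingleton.finite fun p hp q hq => hA.point_unique hp.1 hp.2 hq.1 hq.2
  · rintro y ⟨hy, hyF⟩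
    obtain ⟨D, hD, hyD⟩ := F.mem_carrier_iff.1 hyF
    exact Set.mem_biUnion hD ⟨hyD, hy⟩

lemma finite_nearer (t : T) (i j : Fin 4) (x : Tet) : (F.nearer t i j x).Finite :=
  (F.finite_edge t i j).subset fun _ hy => ⟨hy.1, hy.2.1⟩

variable {F}

lemma level_lt {t : T} {i j : Fin 4} {x y : Tet} (hy : y ∈ Tet.edge i j)
    (hyF : τ.char t y ∈ F.carrier) (h : x.1 i < y.1 i) : F.level t i j y < F.level t i j x := by
  refine Set.ncard_lt_ncard ?_ (F.finite_nearer t i j x)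
  refine ⟨fun z hz => ⟨hz.1, hz.2.1, h.trans hz.2.2⟩, fun hsub => ?_⟩
  exact lt_irrefl _ (hsub (⟨hy, hyF, h⟩ : y ∈ F.nearer t i j x)).2.2

lemma eq_of_level_eq {t : T} {i j : Fin 4} (hij : i ≠ j) {x y : Tet} (hx : x ∈ Tet.edge i j)
    (hy : y ∈ Tet.edge i j) (hxF : τ.char t x ∈ F.carrier) (hyF : τ.char t y ∈ F.carrier)
    (h : F.level t i j x = F.level t i j y) : x = y := by
  apply Tet.eq_of_mem_edge hij hx hy
  rcases lt_trichotomy (x.1 i) (y.1 i) with hlt | heq | hlt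
  · exact absurd h (level_lt hy hyF hlt).ne'
  · exact heq
  · exact absurd h (level_lt hx hxF hlt).ne

/-- A disc that cuts off the vertex `i` in a face has the same level on both edges at `i`. -/
lemma level_eq_of_mem_disc {t : T} {D : Set Tet} (hD : D ∈ F.discs t) {i j k : Fin 4} {p q : Tet}
    (hp : p ∈ D) (hpe : p ∈ Tet.edge i j) (hq : q ∈ D) (hqe : q ∈ Tet.edge i k) :
    F.level t i j p = F.level t i k q := by
  wlog hle : F.level t i k q ≤ F.level t i j p generalizing j k p q
  · exact (this hq hqe hp hpe (le_of_not_ge hle)).symm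
  refine le_antisymm ?_ hle
  obtain ⟨A, hA⟩ := F.discs_normal t D hD
  have key : ∀ y ∈ F.nearer t i j p, ∃ E ∈ F.discs t, ∃ z, y ∈ E ∧ z ∈ E ∧ z ∈ Tet.edge i k ∧
      q.1 i < z.1 i := by
    rintro y ⟨hye, hyF, hlt⟩
    obtain ⟨E, hE, hyE⟩ := F.mem_carrier_iff.1 hyF
    obtain ⟨B, hB⟩ := F.discs_normal t E hE
    have hdisj : Disjoint D E := by
      refine F.discs_disjoint t hD hE ?_
      rintro rfl
      exact hlt.ne (by rw [hA.point_unique hp hpe hyE hye])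
    obtain ⟨z, hz⟩ := hA.exists_nearer hB hdisj (hA.separates_of_mem_edge hp hpe)
      (hA.separates_of_mem_edge hq hqe) hp hpe hq hqe hyE hye hlt
    exact ⟨E, hE, z, hyE, hz⟩
  choose! G hG g hg using key
  refine Set.ncard_le_ncard_of_injOn g (fun y hy => ?_) (fun y hy z hz hyz => ?_)
    (F.finite_nearer t i k q)
  · exact ⟨(hg y hy).2.2.1, F.mem_carrier_iff.2 ⟨_, hG y hy, (hg y hy).2.1⟩, (hg y hy).2.2.2⟩
  · have hE : G y = G z := disc_unique (hG y hy) (hG z hz) (hg y hy).2.1 (hyz ▸ (hg z hz).2.1)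
    obtain ⟨B, hB⟩ := F.discs_normal t _ (hG y hy)
    exact hB.point_unique (hg y hy).1 hy.1 (hE ▸ (hg z hz).1) hz.1

lemma level_glue {t u : T} {f : Fin 4} {σ : Equiv.Perm (Fin 4)} (h : τ.adj t f = some (u, σ))
    {i j : Fin 4} (hi : i ≠ f) (hj : j ≠ f) (x : Tet) :
    F.level u (σ i) (σ j) (Tet.perm σ x) = F.level t i j x := by
  have : F.nearer u (σ i) (σ j) (Tet.perm σ x) = Tet.perm σ '' F.nearer t i j x := by
    ext y
    constructor
    · rintro ⟨h1, h2, h3⟩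
      rw [← Tet.perm_perm_inv σ y] at h1 h2 h3
      rw [Tet.perm_mem_edge] at h1
      rw [Tet.perm_apply, Tet.perm_apply] at h3
      rw [← char_glue h (Tet.edge_subset_face hi hj h1)] at h2
      exact ⟨_, ⟨h1, h2, h3⟩, Tet.perm_perm_inv σ y⟩
    · rintro ⟨x, ⟨h1, h2, h3⟩, rfl⟩
      refine ⟨Tet.perm_mem_edge.2 h1, ?_, by simpa using h3⟩
      rwa [← char_glue h (Tet.edge_subset_face hi hj h1)]
  rw [level, this, Set.ncard_image_of_injective _ (Tet.perm_injective σ), level]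

/-- The arcs of `F` in two glued faces correspond to each other, as they are the components of the
intersection of `F` with the face. -/
lemma exists_glued_disc {t u : T} {f : Fin 4} {σ : Equiv.Perm (Fin 4)}
    (h : τ.adj t f = some (u, σ)) {D : Set Tet} (hD : D ∈ F.discs t)
    (hDf : (D ∩ Tet.face f).Nonempty) :
    ∃ E ∈ F.discs u, E ∩ Tet.face (σ f) = Tet.perm σ '' (D ∩ Tet.face f) := by
  have key : ∀ {t u : T} {f : Fin 4} {σ : Equiv.Perm (Fin 4)}, τ.adj t f = some (u, σ) →
      ∀ D ∈ F.discs t, (D ∩ Tet.face f).Nonempty →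
      ∃ E ∈ F.discs u, Tet.perm σ '' (D ∩ Tet.face f) ⊆ E := by
    rintro t u f σ h D hD ⟨x, hx, hxf⟩
    have hmem : ∀ y ∈ D ∩ Tet.face f, ∃ E ∈ F.discs u, Tet.perm σ y ∈ E := by
      rintro y ⟨hy, hyf⟩
      rw [← F.mem_carrier_iff, ← char_glue h hyf, F.mem_carrier_iff]
      exact ⟨D, hD, hy⟩
    obtain ⟨E, hE, hxE⟩ := hmem x ⟨hx, hxf⟩
    refine ⟨E, hE, ?_⟩
    obtain ⟨A, hA⟩ := F.discs_normal t D hD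
    have hconn := (hA.isPreconnected_inter_face f).image _ (Tet.continuous_perm σ).continuousOn
    have hclosed : ∀ E ∈ F.discs u, IsClosed E := fun E hE =>
      (F.discs_normal u E hE).choose_spec.isClosed
    have hrest : IsClosed (⋃₀ (F.discs u \ {E})) := by
      rw [Set.sUnion_eq_biUnion]
      exact ((F.discs_finite u).subset Set.sdiff_subset).isClosed_biUnion fun G hG =>
        hclosed G hG.1
    have hdisj : ∀ y ∈ E, y ∉ ⋃₀ (F.discs u \ {E}) := by
      rintro y hy ⟨G, hG, hyG⟩
      exact hG.2 (disc_unique hG.1 hE hyG hy)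
    have hcover : Tet.perm σ '' (D ∩ Tet.face f) ⊆ E ∪ ⋃₀ (F.discs u \ {E}) := by
      rintro _ ⟨y, hy, rfl⟩
      obtain ⟨G, hG, hyG⟩ := hmem y hy
      by_cases hGE : G = E
      · exact Or.inl (hGE ▸ hyG)
      · exact Or.inr ⟨G, ⟨hG, hGE⟩, hyG⟩
    have hempty : Tet.perm σ '' (D ∩ Tet.face f) ∩ (E ∩ ⋃₀ (F.discs u \ {E})) = ∅ :=
      Set.eq_empty_of_forall_notMem fun y hy => hdisj y hy.2.1 hy.2.2
    rcases isPreconnected_iff_subset_of_disjoint_closed.1 hconn E _ (hclosed E hE) hrest hcover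
      hempty with hsub | hsub
    · exact hsub
    · exact absurd (hsub ⟨x, ⟨hx, hxf⟩, rfl⟩) (hdisj _ hxE)
  obtain ⟨E, hE, hDE⟩ := key h D hD hDf
  refine ⟨E, hE, Set.Subset.antisymm ?_ ?_⟩
  · obtain ⟨x, hx⟩ := hDf
    have hxE : Tet.perm σ x ∈ E ∩ Tet.face (σ f) := ⟨hDE ⟨x, hx, rfl⟩, Tet.perm_mem_face.2 hx.2⟩
    obtain ⟨D', hD', hED'⟩ := key (τ.adj_symm h) E hE ⟨_, hxE⟩
    have : D' = D := by
      refine disc_unique hD' hD (x := x) (hED' ⟨_, hxE, Tet.perm_inv_perm σ x⟩) hx.1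
    rintro y hy
    refine ⟨Tet.perm σ⁻¹ y, ⟨this ▸ hED' ⟨y, hy, rfl⟩, ?_⟩, Tet.perm_perm_inv σ y⟩
    rw [← Tet.perm_mem_face (σ := σ), Tet.perm_perm_inv]
    exact hy.2
  · exact Set.subset_inter hDE (by rintro _ ⟨x, hx, rfl⟩; exact Tet.perm_mem_face.2 hx.2)

variable (F) in
/-- `D` meets some edge at the vertex `i` of `t` in a point of level `k`. -/
def IsLevel (t : T) (i : Fin 4) (D : Set Tet) (k : ℕ) : Prop :=
  ∃ j, ∃ p ∈ D, p ∈ Tet.edge i j ∧ F.level t i j p = k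

lemma IsLevel.level_eq {t : T} {i j : Fin 4} {D : Set Tet} {k : ℕ} (h : F.IsLevel t i D k)
    (hD : D ∈ F.discs t) {p : Tet} (hp : p ∈ D) (hpe : p ∈ Tet.edge i j) :
    F.level t i j p = k := by
  obtain ⟨l, q, hq, hqe, rfl⟩ := h
  exact level_eq_of_mem_disc hD hp hpe hq hqe

lemma IsLevel.disc_unique {t : T} {i j : Fin 4} {D E : Set Tet} {k : ℕ} (hDk : F.IsLevel t i D k)
    (hEk : F.IsLevel t i E k) (hD : D ∈ F.discs t) (hE : E ∈ F.discs t) {p q : Tet} (hp : p ∈ D)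
    (hpe : p ∈ Tet.edge i j) (hq : q ∈ E) (hqe : q ∈ Tet.edge i j) : D = E := by
  have hij : i ≠ j := (F.discs_normal t D hD).choose_spec.ne_of_mem_edge hp hpe
  have : p = q := eq_of_level_eq hij hpe hqe (F.mem_carrier_iff.2 ⟨D, hD, hp⟩)
    (F.mem_carrier_iff.2 ⟨E, hE, hq⟩)
    ((hDk.level_eq hD hp hpe).trans (hEk.level_eq hE hq hqe).symm)
  exact NormalSurface.disc_unique hD hE hp (this ▸ hq)

lemma exists_isLevel {t : T} {i : Fin 4} {D : Set Tet} (h : Tet.IsNormalTriangle i D) :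
    ∃ k, F.IsLevel t i D k := by
  obtain ⟨j, hj⟩ : ∃ j, i ≠ j := by clear h; revert i; decide
  obtain ⟨p, hp, hpe⟩ := h.exists_mem_edge hj
  exact ⟨_, j, p, hp, hpe, rfl⟩

/-- Across a glued face, a triangle at the corner `i` continues as a triangle at the corresponding
corner or as a quadrilateral, of the same level. -/
lemma exists_glued_triangle {t u : T} {f : Fin 4} {σ : Equiv.Perm (Fin 4)}
    (h : τ.adj t f = some (u, σ)) {D : Set Tet} (hD : D ∈ F.discs t) {i : Fin 4} (hif : i ≠ f)
    (hDi : Tet.IsNormalTriangle i D) :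
    ∃ E ∈ F.discs u, E ∩ Tet.face (σ f) = Tet.perm σ '' (D ∩ Tet.face f) ∧
      (Tet.IsNormalTriangle (σ i) E ∨ Tet.IsNormalQuad E) ∧
      ∀ k, F.IsLevel t i D k → F.IsLevel u (σ i) E k := by
  obtain ⟨E, hE, hED⟩ := exists_glued_disc h hD (hDi.inter_face_nonempty.2 hif)
  have hmem : ∀ j, j ≠ f → ∀ p ∈ D, p ∈ Tet.edge i j → Tet.perm σ p ∈ E := by
    intro j hjf p hp hpe
    have : Tet.perm σ p ∈ E ∩ Tet.face (σ f) := by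
      rw [hED]; exact ⟨p, ⟨hp, Tet.edge_subset_face hif hjf hpe⟩, rfl⟩
    exact this.1
  obtain ⟨j, k, hij, hik, hjk, hjf, hkf⟩ :
      ∃ j k, i ≠ j ∧ i ≠ k ∧ j ≠ k ∧ j ≠ f ∧ k ≠ f := by
    clear hDi hmem hED h; revert i f; decide
  obtain ⟨p, hp, hpe⟩ := hDi.exists_mem_edge hij
  obtain ⟨q, hq, hqe⟩ := hDi.exists_mem_edge hik
  have hpE := hmem j hjf p hp hpe
  have hqE := hmem k hkf q hq hqe
  refine ⟨E, hE, hED, ?_, fun l hl => ?_⟩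
  · obtain ⟨B, hB⟩ := F.discs_normal u E hE
    exact hB.triangle_or_quad_of_mem_edge
      (hB.separates_of_mem_edge hpE (Tet.perm_mem_edge.2 hpe))
      (hB.separates_of_mem_edge hqE (Tet.perm_mem_edge.2 hqe)) (by simpa using hjk)
  · refine ⟨σ j, Tet.perm σ p, hpE, Tet.perm_mem_edge.2 hpe, ?_⟩
    rw [level_glue h hif hjf, hl.level_eq hD hp hpe]

variable (F) in
/-- The triangles of level `k` near the vertex `v` of `M`, recorded by their corners. They form a
subsurface of `F` that is carried into the link of `v` by the projection away from `v`. -/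
def layer (v : τ.Space) (k : ℕ) : Set (T × Fin 4) :=
  {c | τ.CornerAt v c.1 c.2 ∧
    ∃ D ∈ F.discs c.1, Tet.IsNormalTriangle c.2 D ∧ F.IsLevel c.1 c.2 D k}

lemma layer_subset (v : τ.Space) (k : ℕ) : F.layer v k ⊆ τ.linkTriangles v := fun _ hc => hc.1

/-- If a layer is not the whole link of `v`, then a triangle of it has an arc in common with a
quadrilateral. -/
lemma exists_adj_quad {v : τ.Space} {k : ℕ} (hne : (F.layer v k).Nonempty)
    (hlt : F.layer v k ≠ τ.linkTriangles v) :
    ∃ t f u σ i, τ.adj t f = some (u, σ) ∧ i ≠ f ∧ (t, i) ∈ F.layer v k ∧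
      (u, σ i) ∉ F.layer v k ∧ ∃ D ∈ F.discs t, Tet.IsNormalTriangle i D ∧ F.IsLevel t i D k ∧
      ∃ E ∈ F.discs u, Tet.IsNormalQuad E ∧
        E ∩ Tet.face (σ f) = Tet.perm σ '' (D ∩ Tet.face f) := by
  obtain ⟨t, f, u, σ, i, h, hif, ht, hu⟩ : ∃ t f u σ i, τ.adj t f = some (u, σ) ∧ i ≠ f ∧
      (t, i) ∈ F.layer v k ∧ (u, σ i) ∉ F.layer v k := by
    by_contra hcon
    push Not at hcon
    apply hlt
    refine (layer_subset v k).antisymm fun c hc => ?_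
    obtain ⟨c₀, hc₀⟩ := hne
    refine (iff_of_cornerAt (fun t i => (t, i) ∈ F.layer v k) ?_ hc₀.1 hc).1 hc₀
    intro t f u σ i h hif
    refine ⟨hcon t f u σ i h hif, fun hu => ?_⟩
    have := hcon u (σ f) t σ⁻¹ (σ i) (τ.adj_symm h) (by simpa using hif) hu
    simpa using this
  refine ⟨t, f, u, σ, i, h, hif, ht, hu, ?_⟩
  obtain ⟨hv, D, hD, hDi, hDk⟩ := ht
  obtain ⟨E, hE, hED, htype, hEk⟩ := exists_glued_triangle h hD hif hDi
  refine ⟨D, hD, hDi, hDk, E, hE, htype.resolve_left fun hEi => hu ?_, hED⟩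
  exact ⟨(cornerAt_glue h hif).1 hv, E, hE, hEi, hEk k hDk⟩

variable (F) in
/-- The data of a point `x` of `F` on the edge from `i` to `j` as seen from `i`: the vertex `i`, the
level of `x`, and the end of the edge at `i`. -/
noncomputable def view (t : T) (i j : Fin 4) (x : Tet) : Σ _ : τ.Space × ℕ, τ.Space :=
  ⟨(τ.char t (Tet.vertex i), F.level t i j x), τ.germ t i j⟩

lemma view_glue {t u : T} {f : Fin 4} {σ : Equiv.Perm (Fin 4)} (h : τ.adj t f = some (u, σ))
    {i j : Fin 4} (hij : i ≠ j) (hi : i ≠ f) (hj : j ≠ f) (x : Tet) :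
    F.view u (σ i) (σ j) (Tet.perm σ x) = F.view t i j x := by
  rw [view, view, level_glue h hi hj, germ_glue h hij hi hj,
    char_glue h (vertex_mem_face.2 hi), Tet.perm_vertex]

/-- A point of `F` on an edge of the triangulation has only two views, from both ends of the edge. -/
lemma view_of_char_eq {t u : T} {i j k l : Fin 4} {x y : Tet} (hx : x ∈ Tet.edge i j)
    (hy : y ∈ Tet.edge k l) (hF : τ.char t x ∈ F.carrier) (h : τ.char t x = τ.char u y) :
    F.view u k l y = F.view t i j x ∨ F.view u k l y = F.view t j i x := by
  let w := F.view t i j x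
  let w' := F.view t j i x
  have hval : ∀ (t : T) (x : Tet) (i j : Fin 4), τ.char t x ∈ F.carrier → x ∈ Tet.edge i j →
      i ≠ j ∧ x.1 i ≠ 0 ∧ x.1 j ≠ 0 := by
    intro t x i j hF hx
    obtain ⟨D, hD, hxD⟩ := F.mem_carrier_iff.1 hF
    obtain ⟨A, hA⟩ := F.discs_normal t D hD
    exact ⟨hA.ne_of_mem_edge hxD hx, hA.apply_ne_zero hxD hx,
      hA.apply_ne_zero hxD (Tet.edge_comm i j ▸ hx)⟩
  refine (iff_of_char_eq (τ := τ) (fun t x => τ.char t x ∈ F.carrier → ∀ i j, x ∈ Tet.edge i j →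
    F.view t i j x = w ∨ F.view t i j x = w') ?_ h).1 ?_ (h ▸ hF) k l hy
  · intro t f u σ x h hx
    rw [← char_glue h hx]
    refine forall_congr' fun hF => ?_
    constructor
    · intro H i j hij
      obtain ⟨i, rfl⟩ := σ.surjective i
      obtain ⟨j, rfl⟩ := σ.surjective j
      rw [Tet.perm_mem_edge] at hij
      obtain ⟨h1, h2, h3⟩ := hval t x i j hF hij
      rw [view_glue h h1 (fun e => h2 (e ▸ hx)) (fun e => h3 (e ▸ hx))]
      exact H i j hij
    · intro H i j hij
      obtain ⟨h1, h2, h3⟩ := hval t x i j hF hij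
      rw [← view_glue h h1 (fun e => h2 (e ▸ hx)) (fun e => h3 (e ▸ hx))]
      exact H _ _ (Tet.perm_mem_edge.2 hij)
  · intro _ k l hkl
    obtain ⟨D, hD, hxD⟩ := F.mem_carrier_iff.1 hF
    obtain ⟨A, hA⟩ := F.discs_normal t D hD
    rcases hA.edge_unique hxD hx hkl with ⟨rfl, rfl⟩ | ⟨rfl, rfl⟩
    · exact Or.inl rfl
    · exact Or.inr rfl

/-- At a point of `F` on an edge that is not a corner of a quadrilateral, all discs are triangles
that cut off the same end of the edge. -/
lemma view_unique {t u : T} {i j k l : Fin 4} {x y : Tet} {D E : Set Tet} (hD : D ∈ F.discs t)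
    (hDi : Tet.IsNormalTriangle i D) (hxD : x ∈ D) (hx : x ∈ Tet.edge i j)
    (hE : E ∈ F.discs u) (hEk : Tet.IsNormalTriangle k E) (hyE : y ∈ E)
    (hy : y ∈ Tet.edge k l) (h : τ.char t x = τ.char u y)
    (hquad : ∀ t' x' D', D' ∈ F.discs t' → x' ∈ D' → τ.char t' x' = τ.char t x →
      ¬Tet.IsNormalQuad D') :
    F.view u k l y = F.view t i j x := by
  let w := F.view t i j x
  let P : T → Tet → Prop := fun t' x' => τ.char t' x' = τ.char t x → ∀ i j D,
    D ∈ F.discs t' → Tet.IsNormalTriangle i D → x' ∈ D → x' ∈ Tet.edge i j → F.view t' i j x' = w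
  have hstep : ∀ t₁ f u₁ σ x₁, τ.adj t₁ f = some (u₁, σ) → x₁ ∈ Tet.face f →
      P u₁ (Tet.perm σ x₁) → P t₁ x₁ := by
    intro t₁ f u₁ σ x₁ h hf H hp a b G hG hGa hxG hab
    have hval := Tet.IsNormalDisc.apply_ne_zero hGa hxG hab
    have hval' := Tet.IsNormalDisc.apply_ne_zero hGa hxG (Tet.edge_comm a b ▸ hab)
    have haf : a ≠ f := fun e => hval (e ▸ hf)
    have hbf : b ≠ f := fun e => hval' (e ▸ hf)
    rw [← view_glue h (Tet.IsNormalDisc.ne_of_mem_edge hGa hxG hab) haf hbf]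
    obtain ⟨G', hG', hGG', htype, -⟩ := exists_glued_triangle h hG haf hGa
    have hxG' : Tet.perm σ x₁ ∈ G' := by
      have : Tet.perm σ x₁ ∈ G' ∩ Tet.face (σ f) := by rw [hGG']; exact ⟨x₁, ⟨hxG, hf⟩, rfl⟩
      exact this.1
    rw [char_glue h hf] at hp
    exact H hp _ _ G' hG' (htype.resolve_right (hquad _ _ G' hG' hxG' hp)) hxG'
      (Tet.perm_mem_edge.2 hab)
  refine (iff_of_char_eq (τ := τ) P ?_ h).1 ?_ h.symm k l E hE hEk hyE hy
  · intro t₁ f u₁ σ x₁ h hf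
    refine ⟨fun H => ?_, hstep t₁ f u₁ σ x₁ h hf⟩
    refine hstep u₁ (σ f) t₁ σ⁻¹ _ (τ.adj_symm h) (Tet.perm_mem_face.2 hf) ?_
    rwa [Tet.perm_inv_perm]
  · intro _ a b G hG hGa hxG hab
    have := disc_unique hD hG hxD hxG
    subst this
    have hai := hDi.unique hGa
    subst hai
    rcases Tet.IsNormalDisc.edge_unique hDi hxD hx hab with ⟨-, rfl⟩ | ⟨rfl, rfl⟩ <;> rfl

/-- The point of level `k` on an edge, seen from an end of the edge, is determined by this end. -/
lemma char_eq_of_germ_eq {t u : T} {i j k l : Fin 4} (hij : i ≠ j) (hkl : k ≠ l) {x y : Tet}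
    (hx : x ∈ Tet.edge i j) (hy : y ∈ Tet.edge k l) (hxF : τ.char t x ∈ F.carrier)
    (hyF : τ.char u y ∈ F.carrier) (hlevel : F.level t i j x = F.level u k l y)
    (h : τ.germ t i j = τ.germ u k l) : τ.char t x = τ.char u y := by
  let Z : T → Fin 4 → Fin 4 → Prop := fun t' a b => ∃ z, z ∈ Tet.edge a b ∧
    τ.char t' z = τ.char t x ∧ F.level t' a b z = F.level t i j x
  have hZ : ∀ t f u σ a b, τ.adj t f = some (u, σ) → a ≠ b → a ≠ f → b ≠ f →
      (Z t a b ↔ Z u (σ a) (σ b)) := by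
    intro t f u σ a b h hab ha hb
    constructor
    · rintro ⟨z, hz, hzx, hzl⟩
      refine ⟨Tet.perm σ z, Tet.perm_mem_edge.2 hz, ?_, ?_⟩
      · rw [← char_glue h (Tet.edge_subset_face ha hb hz), hzx]
      · rw [level_glue h ha hb, hzl]
    · rintro ⟨z, hz, hzx, hzl⟩
      rw [← Tet.perm_perm_inv σ z] at hz hzx hzl
      rw [Tet.perm_mem_edge] at hz
      rw [level_glue h ha hb] at hzl
      rw [← char_glue h (Tet.edge_subset_face ha hb hz)] at hzx
      exact ⟨_, hz, hzx, hzl⟩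
  obtain ⟨z, hz, hzx, hzl⟩ := (iff_of_germ_eq Z hZ hij hkl h).1 ⟨x, hx, rfl, rfl⟩
  rw [← hzx, eq_of_level_eq hkl hz hy (hzx ▸ hxF) hyF (hzl.trans hlevel)]

end NormalSurface

/-! ### The discs and the quadrilaterals -/

namespace NormalSurface

open PseudoTriangulation

variable {T : Type*} {τ : PseudoTriangulation T} (F : NormalSurface τ)

/-- The discs of `F`. -/
noncomputable def allDiscs [Fintype T] : Finset (Σ _ : T, Set Tet) :=
  Finset.univ.sigma fun t => (F.discs_finite t).toFinset

open Classical in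
/-- The quadrilaterals of `F`. -/
noncomputable def quads [Fintype T] : Finset (Σ _ : T, Set Tet) :=
  F.allDiscs.filter fun d => Tet.IsNormalQuad d.2

variable {F}

lemma mem_allDiscs [Fintype T] {d : Σ _ : T, Set Tet} : d ∈ F.allDiscs ↔ d.2 ∈ F.discs d.1 := by
  simp [allDiscs]

lemma mem_quads [Fintype T] {d : Σ _ : T, Set Tet} :
    d ∈ F.quads ↔ d.2 ∈ F.discs d.1 ∧ Tet.IsNormalQuad d.2 := by
  simp [quads, mem_allDiscs]

lemma card_allDiscs [Fintype T] : F.allDiscs.card = ∑ t, (F.discs t).ncard := by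
  rw [allDiscs, Finset.card_sigma]
  exact Finset.sum_congr rfl fun t _ => (Set.ncard_eq_toFinset_card _ _).symm

lemma card_quads [Fintype T] : F.quads.card = F.numQuads := by
  classical
  have : F.quads = Finset.univ.sigma fun t =>
      ((F.discs_finite t).toFinset.filter fun D => Tet.IsNormalQuad D) := by
    ext d; simp [mem_quads]
  rw [this, Finset.card_sigma, numQuads]
  refine Finset.sum_congr rfl fun t _ => ?_
  rw [← Set.ncard_coe_finset]
  congr 1
  ext D; simp

/-! ### The layers -/

/-- The vertex cut off by a triangle; an arbitrary vertex for other discs. -/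
noncomputable def apex (d : Σ _ : T, Set Tet) : Fin 4 :=
  Classical.epsilon fun i => Tet.IsNormalTriangle i d.2

variable (F) in
/-- The level of a triangle, seen from the vertex that it cuts off; meaningless for quadrilaterals. -/
noncomputable def discLevel (d : Σ _ : T, Set Tet) : ℕ :=
  Classical.epsilon fun k => F.IsLevel d.1 (apex d) d.2 k

variable (F) in
open Classical in
/-- The pairs of a vertex `v` of `M` and a level `k` with a nonempty layer. -/
noncomputable def layerIndices [Fintype T] : Finset (τ.Space × ℕ) :=
  (F.allDiscs \ F.quads).image fun d => (τ.char d.1 (Tet.vertex (apex d)), F.discLevel d)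

lemma apex_eq {t : T} {D : Set Tet} {i : Fin 4} (h : Tet.IsNormalTriangle i D) :
    apex (⟨t, D⟩ : Σ _ : T, Set Tet) = i :=
  h.unique (Classical.epsilon_spec (p := fun i => Tet.IsNormalTriangle i D) ⟨i, h⟩)

lemma IsLevel.unique {t : T} {D : Set Tet} {i : Fin 4} {k l : ℕ} (hD : D ∈ F.discs t)
    (hk : F.IsLevel t i D k) (hl : F.IsLevel t i D l) : k = l := by
  obtain ⟨j, p, hp, hpe, rfl⟩ := hk
  exact hl.level_eq hD hp hpe

lemma discLevel_eq {t : T} {D : Set Tet} {i : Fin 4} {k : ℕ} (hD : D ∈ F.discs t)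
    (h : Tet.IsNormalTriangle i D) (hk : F.IsLevel t i D k) :
    F.discLevel (⟨t, D⟩ : Σ _ : T, Set Tet) = k := by
  rw [discLevel, apex_eq h]
  exact IsLevel.unique hD (Classical.epsilon_spec (p := fun k => F.IsLevel t i D k) ⟨k, hk⟩) hk

lemma mem_layerIndices [Fintype T] {v : τ.Space} {k : ℕ} :
    (v, k) ∈ F.layerIndices ↔ (F.layer v k).Nonempty := by
  classical
  rw [layerIndices, Finset.mem_image]
  constructor
  · rintro ⟨⟨t, D⟩, hd, he⟩
    rw [Finset.mem_sdiff, mem_allDiscs, mem_quads] at hd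
    obtain ⟨A, hA⟩ := F.discs_normal t D hd.1
    obtain ⟨i, hi⟩ := hA.triangle_or_quad.resolve_right fun h => hd.2 ⟨hd.1, h⟩
    obtain ⟨l, hl⟩ := F.exists_isLevel (t := t) hi
    rw [apex_eq hi, discLevel_eq hd.1 hi hl, Prod.mk.injEq] at he
    obtain ⟨rfl, rfl⟩ := he
    exact ⟨(t, i), cornerAt_iff.2 rfl, D, hd.1, hi, hl⟩
  · rintro ⟨⟨t, i⟩, hc, D, hD, hi, hk⟩
    refine ⟨⟨t, D⟩, ?_, ?_⟩
    · rw [Finset.mem_sdiff, mem_allDiscs, mem_quads]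
      exact ⟨hD, fun h => hi.not_quad h.2⟩
    · rw [apex_eq hi, discLevel_eq hD hi hk, cornerAt_iff.1 hc]

lemma sum_ncard_layer_add_numQuads_le [Fintype T] :
    ∑ w ∈ F.layerIndices, (F.layer w.1 w.2).ncard + F.numQuads ≤ ∑ t, (F.discs t).ncard := by
  classical
  have hsub : F.quads ⊆ F.allDiscs := fun d hd => mem_allDiscs.2 (mem_quads.1 hd).1
  rw [← card_quads, ← card_allDiscs, ← Finset.card_sdiff_add_card_eq_card hsub]
  refine Nat.add_le_add_right ?_ _
  let X : τ.Space × ℕ → Finset (T × Fin 4) := fun w => (Set.toFinite (F.layer w.1 w.2)).toFinset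
  have hX : ∑ w ∈ F.layerIndices, (F.layer w.1 w.2).ncard = (F.layerIndices.sigma X).card := by
    rw [Finset.card_sigma]
    exact Finset.sum_congr rfl fun w _ => Set.ncard_eq_toFinset_card _ _
  rw [hX]
  refine (Finset.card_le_card ?_).trans (Finset.card_image_le (s := F.allDiscs \ F.quads)
    (f := fun d => ⟨(τ.char d.1 (Tet.vertex (apex d)), F.discLevel d), (d.1, apex d)⟩))
  rintro ⟨⟨v, k⟩, ⟨t, i⟩⟩ hw
  rw [Finset.mem_sigma, Set.Finite.mem_toFinset] at hw
  obtain ⟨hc, D, hD, hi, hk⟩ := hw.2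
  refine Finset.mem_image.2 ⟨⟨t, D⟩, ?_, ?_⟩
  · rw [Finset.mem_sdiff, mem_allDiscs, mem_quads]
    exact ⟨hD, fun h => hi.not_quad h.2⟩
  · rw [apex_eq hi, discLevel_eq hD hi hk, cornerAt_iff.1 hc]

/-! ### The arcs -/

/-- Every arc is a side of a quadrilateral or lies between two triangles of the same layer. -/
lemma ncard_arcs_le [Fintype T] :
    F.arcs.ncard ≤
      ∑ w ∈ F.layerIndices, (τ.innerEdges w.1 (F.layer w.1 w.2)).ncard + 4 * F.numQuads := by
  classical
  let side : (Σ _ : T, Set Tet) × Fin 4 → Set τ.Space := fun s =>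
    τ.char s.1.1 '' (s.1.2 ∩ Tet.face s.2)
  let S : Finset (Set τ.Space) := (F.quads ×ˢ Finset.univ).image side
  have hS : S.card ≤ 4 * F.numQuads := by
    refine Finset.card_image_le.trans ?_
    rw [Finset.card_product, card_quads, Finset.card_univ, Fintype.card_fin, mul_comm]
  have hfin : ∀ v X, (τ.innerEdges v X).Finite := fun v X =>
    (finite_linkEdges v).subset fun _ h => h.1
  let N : Finset (Σ _ : τ.Space × ℕ, Set τ.Space) := F.layerIndices.sigma fun w =>
    (hfin w.1 (F.layer w.1 w.2)).toFinset
  have hN : N.card = ∑ w ∈ F.layerIndices, (τ.innerEdges w.1 (F.layer w.1 w.2)).ncard := by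
    rw [Finset.card_sigma]
    exact Finset.sum_congr rfl fun w _ => (Set.ncard_eq_toFinset_card _ _).symm
  let R : Set τ.Space → (Σ _ : τ.Space × ℕ, Set τ.Space) → Prop := fun a w =>
    ∃ t i f D k, D ∈ F.discs t ∧ Tet.IsNormalTriangle i D ∧ i ≠ f ∧ F.IsLevel t i D k ∧
      w = ⟨(τ.char t (Tet.vertex i), k), τ.linkEdge t i f⟩ ∧ a = τ.char t '' (D ∩ Tet.face f)
  have hR : ∀ a ∈ F.arcs \ S, ∃ w ∈ N, R a w := by
    rintro a ⟨⟨t, D, hD, f, hf, rfl⟩, haS⟩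
    have hnotquad : ∀ u E g, E ∈ F.discs u →
        τ.char t '' (D ∩ Tet.face f) = τ.char u '' (E ∩ Tet.face g) → ¬Tet.IsNormalQuad E := by
      intro u E g hE he hq
      refine haS (Finset.mem_coe.2 (Finset.mem_image.2 ⟨(⟨u, E⟩, g), ?_, he.symm⟩))
      exact Finset.mem_product.2 ⟨mem_quads.2 ⟨hE, hq⟩, Finset.mem_univ _⟩
    obtain ⟨A, hA⟩ := F.discs_normal t D hD
    obtain ⟨i, hi⟩ := hA.triangle_or_quad.resolve_right (hnotquad t D f hD rfl)
    have hif := hi.inter_face_nonempty.1 hf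
    obtain ⟨k, hk⟩ := F.exists_isLevel (t := t) hi
    refine ⟨⟨(τ.char t (Tet.vertex i), k), τ.linkEdge t i f⟩, ?_, t, i, f, D, k, hD, hi, hif, hk,
      rfl, rfl⟩
    have hlayer : (t, i) ∈ F.layer (τ.char t (Tet.vertex i)) k :=
      ⟨cornerAt_iff.2 rfl, D, hD, hi, hk⟩
    rw [Finset.mem_sigma, Set.Finite.mem_toFinset]
    refine ⟨mem_layerIndices.2 ⟨_, hlayer⟩, ⟨t, i, f, hif, cornerAt_iff.2 rfl, rfl⟩, ?_⟩
    intro u j g hjg he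
    rcases eq_or_glued_of_linkEdge_eq hif he with ⟨rfl, rfl, rfl⟩ | ⟨σ, hσ, rfl, rfl⟩
    · exact hlayer
    · obtain ⟨E, hE, hED, htype, hEk⟩ := exists_glued_triangle hσ hD hif hi
      have hEi := htype.resolve_right (hnotquad u E (σ f) hE (by
        rw [hED, image_glue hσ Set.inter_subset_right]))
      exact ⟨(cornerAt_glue hσ hif).1 (cornerAt_iff.2 rfl), E, hE, hEi, hEk k hk⟩
  have hinj : ∀ a b w, R a w → R b w → a = b := by
    rintro _ _ w ⟨t, i, f, D, k, hD, hi, hif, hk, hw, rfl⟩ ⟨u, j, g, E, l, hE, hj, hjg, hl, hw', rfl⟩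
    rw [hw] at hw'
    simp only [Sigma.mk.injEq, Prod.mk.injEq, heq_eq_eq] at hw'
    obtain ⟨⟨-, rfl⟩, he⟩ := hw'
    obtain ⟨m, hm, hmf⟩ : ∃ m, i ≠ m ∧ m ≠ f := by
      clear hw he hi hk hif; revert i f; decide
    rcases eq_or_glued_of_linkEdge_eq hif he with ⟨rfl, rfl, rfl⟩ | ⟨σ, hσ, rfl, rfl⟩
    · obtain ⟨p, hp, hpe⟩ := hi.exists_mem_edge hm
      obtain ⟨q, hq, hqe⟩ := hj.exists_mem_edge hm
      rw [hk.disc_unique hl hD hE hp hpe hq hqe]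
    · obtain ⟨E', hE', hED, -, hEk⟩ := exists_glued_triangle hσ hD hif hi
      obtain ⟨p, hp, hpe⟩ := hi.exists_mem_edge hm
      obtain ⟨q, hq, hqe⟩ := hj.exists_mem_edge (j := σ m) (by simpa using hm)
      have hpE : Tet.perm σ p ∈ E' ∩ Tet.face (σ f) := by
        rw [hED]; exact ⟨p, ⟨hp, Tet.edge_subset_face hif hmf hpe⟩, rfl⟩
      rw [← (hEk k hk).disc_unique hl hE' hE hpE.1 (Tet.perm_mem_edge.2 hpe) hq hqe, hED,
        image_glue hσ Set.inter_subset_right]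
  have hdiff : (F.arcs \ S).ncard ≤ N.card := by
    rcases (F.arcs \ (S : Set (Set τ.Space))).eq_empty_or_nonempty with h0 | ⟨a₀, ha₀⟩
    · rw [h0, Set.ncard_empty]; exact Nat.zero_le _
    have : Nonempty (Σ _ : τ.Space × ℕ, Set τ.Space) := ⟨(hR a₀ ha₀).choose⟩
    choose! w hwN hwR using hR
    rw [← Set.ncard_coe_finset]
    exact Set.ncard_le_ncard_of_injOn w (fun a ha => hwN a ha)
      (fun a ha b hb hab => hinj a b (w a) (hwR a ha) (hab ▸ hwR b hb)) N.finite_toSet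
  have := Set.ncard_le_ncard_sdiff_add_ncard F.arcs (S : Set (Set τ.Space)) S.finite_toSet
  rw [Set.ncard_coe_finset] at this
  omega

/-! ### The vertices -/

lemma finite_vertices [Finite T] : F.vertices.Finite := by
  refine (Set.finite_iUnion fun s : T × Fin 4 × Fin 4 =>
    (F.finite_edge s.1 s.2.1 s.2.2).image (τ.char s.1)).subset ?_
  rintro _ ⟨hp, t, x, ⟨i, j, hx⟩, rfl⟩
  exact Set.mem_iUnion.2 ⟨(t, i, j), x, ⟨hx, hp⟩, rfl⟩

lemma exists_edge_of_char_eq {t u : T} {x y : Tet} {i j : Fin 4} (hx : x ∈ Tet.edge i j)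
    (h : τ.char t x = τ.char u y) : ∃ k l, y ∈ Tet.edge k l := by
  refine (iff_of_char_eq (τ := τ) (fun _ x => ∃ i j, x ∈ Tet.edge i j) ?_ h).1 ⟨i, j, hx⟩
  intro t f u σ x _ _
  constructor
  · rintro ⟨i, j, h⟩; exact ⟨_, _, Tet.perm_mem_edge.2 h⟩
  · rintro ⟨i, j, h⟩
    obtain ⟨i, rfl⟩ := σ.surjective i
    obtain ⟨j, rfl⟩ := σ.surjective j
    exact ⟨_, _, Tet.perm_mem_edge.1 h⟩

/-- The two vertices on one side of a quadrilateral, the side being chosen arbitrarily. -/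
noncomputable def quadSide (D : Set Tet) : Finset (Fin 4) :=
  Classical.epsilon fun A => A.card = 2 ∧ Tet.IsNormalDisc A D

lemma quadSide_spec {D : Set Tet} (h : Tet.IsNormalQuad D) :
    (quadSide D).card = 2 ∧ Tet.IsNormalDisc (quadSide D) D :=
  Classical.epsilon_spec h

variable (F) in
/-- The corners of the quadrilaterals of `F`, given by the edges on which they lie. -/
noncomputable def quadCorners [Fintype T] : Finset (Σ _ : (Σ _ : T, Set Tet), Fin 4 × Fin 4) :=
  F.quads.sigma fun d => quadSide d.2 ×ˢ (quadSide d.2)ᶜ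

variable (τ) in
/-- The point of `M` at a corner of a disc, given by the disc and the edge on which the corner lies. -/
noncomputable def cornerPoint (s : Σ _ : (Σ _ : T, Set Tet), Fin 4 × Fin 4) : τ.Space :=
  haveI : Nonempty Tet := ⟨Tet.vertex 0⟩
  τ.char s.1.1 (Classical.epsilon fun x => x ∈ s.1.2 ∧ x ∈ Tet.edge s.2.1 s.2.2)

lemma cornerPoint_eq {t : T} {D : Set Tet} {i j : Fin 4} {x : Tet} (hD : D ∈ F.discs t)
    (hx : x ∈ D) (hxe : x ∈ Tet.edge i j) : cornerPoint τ ⟨⟨t, D⟩, (i, j)⟩ = τ.char t x := by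
  have : Nonempty Tet := ⟨Tet.vertex 0⟩
  obtain ⟨A, hA⟩ := F.discs_normal t D hD
  have := Classical.epsilon_spec (p := fun x => x ∈ D ∧ x ∈ Tet.edge i j) ⟨x, hx, hxe⟩
  exact congrArg (τ.char t) (hA.point_unique this.1 this.2 hx hxe)

lemma card_quadCorners [Fintype T] : F.quadCorners.card = 4 * F.numQuads := by
  rw [quadCorners, Finset.card_sigma, ← card_quads, mul_comm, ← smul_eq_mul, ← Finset.sum_const]
  refine Finset.sum_congr rfl fun d hd => ?_
  have := (quadSide_spec (mem_quads.1 hd).2).1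
  rw [Finset.card_product, Finset.card_compl, this, Fintype.card_fin]

/-- Near the vertex `i`, one of the two orders of the ends of an edge names a corner of a
quadrilateral, the same one for all edges from `i` that the quadrilateral meets. -/
lemma exists_mem_quadCorners [Fintype T] {t : T} {D : Set Tet} (hD : D ∈ F.discs t)
    (hq : Tet.IsNormalQuad D) (i : Fin 4) :
    (∀ j, ∀ x ∈ D, x ∈ Tet.edge i j → ⟨⟨t, D⟩, (i, j)⟩ ∈ F.quadCorners) ∨
      ∀ j, ∀ x ∈ D, x ∈ Tet.edge i j → ⟨⟨t, D⟩, (j, i)⟩ ∈ F.quadCorners := by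
  have hA := (quadSide_spec hq).2
  have hmem : (⟨t, D⟩ : Σ _ : T, Set Tet) ∈ F.quads := mem_quads.2 ⟨hD, hq⟩
  by_cases hi : i ∈ quadSide D
  · refine Or.inl fun j x hx hxe => ?_
    have := hA.separates_of_mem_edge hx hxe
    simp only [quadCorners, Finset.mem_sigma, Finset.mem_product, Finset.mem_compl]
    exact ⟨hmem, hi, by tauto⟩
  · refine Or.inr fun j x hx hxe => ?_
    have := hA.separates_of_mem_edge hx hxe
    simp only [quadCorners, Finset.mem_sigma, Finset.mem_product, Finset.mem_compl]
    exact ⟨hmem, by tauto, hi⟩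

variable (F) in
open Classical in
/-- The vertices of `F` that lie on quadrilaterals. -/
noncomputable def quadVertices [Fintype T] : Finset τ.Space := F.quadCorners.image (cornerPoint τ)

lemma mem_quadVertices [Fintype T] {t : T} {D : Set Tet} (hD : D ∈ F.discs t)
    (hq : Tet.IsNormalQuad D) {i j : Fin 4} {x : Tet} (hx : x ∈ D) (hxe : x ∈ Tet.edge i j) :
    τ.char t x ∈ F.quadVertices := by
  classical
  rcases exists_mem_quadCorners hD hq i with h | h
  · exact Finset.mem_image.2 ⟨_, h j x hx hxe, cornerPoint_eq hD hx hxe⟩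
  · exact Finset.mem_image.2 ⟨_, h j x hx hxe, cornerPoint_eq hD hx (Tet.edge_comm i j ▸ hxe)⟩

lemma exists_of_mem_quadVertices [Fintype T] {p : τ.Space} (hp : p ∈ F.quadVertices) :
    ∃ t D i j x, D ∈ F.discs t ∧ Tet.IsNormalQuad D ∧ x ∈ D ∧ x ∈ Tet.edge i j ∧
      p = τ.char t x := by
  classical
  obtain ⟨⟨⟨t, D⟩, ⟨i, j⟩⟩, hs, rfl⟩ := Finset.mem_image.1 hp
  simp only [quadCorners, Finset.mem_sigma, Finset.mem_product, Finset.mem_compl] at hs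
  obtain ⟨hd, hi, hj⟩ := hs
  obtain ⟨hD, hq⟩ := mem_quads.1 hd
  obtain ⟨x, hx, hxe⟩ := (quadSide_spec hq).2.exists_mem_edge hi hj
  exact ⟨t, D, i, j, x, hD, hq, hx, hxe, cornerPoint_eq hD hx hxe⟩

variable (F) in
/-- The vertex `p` of `F` lies, as seen from one end of its edge, on the layer `w.1` over the link
vertex `w.2`. -/
def LiesOver (p : τ.Space) (w : Σ _ : τ.Space × ℕ, τ.Space) : Prop :=
  ∃ t i j x D, i ≠ j ∧ D ∈ F.discs t ∧ Tet.IsNormalTriangle i D ∧ x ∈ D ∧ x ∈ Tet.edge i j ∧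
    w = F.view t i j x ∧ p = τ.char t x

/-- A vertex of `F` lies on at most two layers, one for each end of its edge, and on two of them
only if it lies on a quadrilateral. Hence the vertices of all layers outnumber those of `F` by at
most the number of the vertices on quadrilaterals, and by less if one of the latter is on no
layer. -/
lemma sum_ncard_verticesOf_le [Fintype T] :
    ∑ w ∈ F.layerIndices, (τ.verticesOf (F.layer w.1 w.2)).ncard ≤
      F.vertices.ncard + F.quadVertices.card ∧
    ((∃ p ∈ F.quadVertices, ∀ w, ¬F.LiesOver p w) →
      ∑ w ∈ F.layerIndices, (τ.verticesOf (F.layer w.1 w.2)).ncard <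
        F.vertices.ncard + F.quadVertices.card) := by
  classical
  have hfin : ∀ v k, (τ.verticesOf (F.layer v k)).Finite := fun v k =>
    (finite_linkVertices v).subset (verticesOf_subset (layer_subset v k))
  let W : Finset (Σ _ : τ.Space × ℕ, τ.Space) := F.layerIndices.sigma fun w =>
    (hfin w.1 w.2).toFinset
  have hW : ∑ w ∈ F.layerIndices, (τ.verticesOf (F.layer w.1 w.2)).ncard = W.card := by
    rw [Finset.card_sigma]
    exact Finset.sum_congr rfl fun w _ => Set.ncard_eq_toFinset_card _ _
  have hex : ∀ w, ∃ p, w ∈ W → F.LiesOver p w := by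
    rintro ⟨⟨v, k⟩, g⟩
    by_cases hw : ⟨(v, k), g⟩ ∈ W
    swap
    · exact ⟨v, fun h => absurd h hw⟩
    rw [Finset.mem_sigma, Set.Finite.mem_toFinset] at hw
    obtain ⟨⟨t, i⟩, ⟨hc, D, hD, hi, hk⟩, j, hij, rfl⟩ := hw.2
    obtain ⟨x, hx, hxe⟩ := hi.exists_mem_edge hij
    refine ⟨τ.char t x, fun _ => ⟨t, i, j, x, D, hij, hD, hi, hx, hxe, ?_, rfl⟩⟩
    rw [view, cornerAt_iff.1 hc, hk.level_eq hD hx hxe]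
  choose pt hpt using hex
  let V : Finset τ.Space := F.finite_vertices.toFinset
  have hV : V.card = F.vertices.ncard := (Set.ncard_eq_toFinset_card _ _).symm
  have hmaps : ∀ w ∈ W, pt w ∈ V := by
    intro w hw
    obtain ⟨t, i, j, x, D, -, hD, -, hx, hxe, -, hp⟩ := hpt w hw
    rw [Set.Finite.mem_toFinset, hp]
    exact ⟨F.mem_carrier_iff.2 ⟨D, hD, hx⟩, t, x, ⟨i, j, hxe⟩, rfl⟩
  have hPV : F.quadVertices ⊆ V := by
    intro p hp
    obtain ⟨t, D, i, j, x, hD, -, hx, hxe, rfl⟩ := exists_of_mem_quadVertices hp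
    rw [Set.Finite.mem_toFinset]
    exact ⟨F.mem_carrier_iff.2 ⟨D, hD, hx⟩, t, x, ⟨i, j, hxe⟩, rfl⟩
  have hfiber : ∀ p ∈ V, (W.filter fun w => pt w = p).card ≤
      1 + if p ∈ F.quadVertices then 1 else 0 := by
    intro p _
    rcases (W.filter fun w => pt w = p).eq_empty_or_nonempty with h0 | ⟨w, hw⟩
    · rw [h0]; simp
    obtain ⟨hwW, rfl⟩ := Finset.mem_filter.1 hw
    obtain ⟨t, i, j, x, D, hij, hD, hi, hx, hxe, hwv, hp⟩ := hpt w hwW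
    have hxF := F.mem_carrier_iff.2 ⟨D, hD, hx⟩
    split_ifs with hq
    · refine (Finset.card_le_card (t := {F.view t i j x, F.view t j i x}) ?_).trans
        Finset.card_le_two
      intro w' hw'
      obtain ⟨hw'W, hpp⟩ := Finset.mem_filter.1 hw'
      obtain ⟨u, k, l, y, E, -, -, -, -, hye, hwv', hp'⟩ := hpt w' hw'W
      rw [Finset.mem_insert, Finset.mem_singleton, hwv']
      exact view_of_char_eq hxe hye hxF (by rw [← hp, ← hp', hpp])
    · refine (Finset.card_le_card (t := {F.view t i j x}) ?_).trans (by simp)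
      intro w' hw'
      obtain ⟨hw'W, hpp⟩ := Finset.mem_filter.1 hw'
      obtain ⟨u, k, l, y, E, -, hE, hk, hy, hye, hwv', hp'⟩ := hpt w' hw'W
      rw [Finset.mem_singleton, hwv']
      refine view_unique hD hi hx hxe hE hk hy hye (by rw [← hp, ← hp', hpp]) ?_
      intro t' x' D' hD' hx' he hquad
      obtain ⟨a, b, hab⟩ := exists_edge_of_char_eq hxe he.symm
      exact hq (by rw [hp, ← he]; exact mem_quadVertices hD' hquad hx' hab)
  have hsum : ∑ p ∈ V, (1 + if p ∈ F.quadVertices then 1 else 0) =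
      F.vertices.ncard + F.quadVertices.card := by
    rw [Finset.sum_add_distrib, Finset.sum_ite_mem, Finset.inter_eq_right.2 hPV]
    simp [hV]
  rw [hW, Finset.card_eq_sum_card_fiberwise hmaps, ← hsum]
  refine ⟨Finset.sum_le_sum hfiber, ?_⟩
  rintro ⟨p, hp, hnone⟩
  refine Finset.sum_lt_sum hfiber ⟨p, hPV hp, ?_⟩
  have h0 : (W.filter fun w => pt w = p) = ∅ := by
    refine Finset.filter_eq_empty_iff.2 fun w hw he => hnone w ?_
    rw [← he]; exact hpt w hw
  rw [h0, if_pos hp, Finset.card_empty]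
  norm_num

/-! ### The inequality -/

/-- The contribution of a layer to the Euler characteristic of `F`. -/
noncomputable def contribution (F : NormalSurface τ) (w : τ.Space × ℕ) : ℤ :=
  ((τ.verticesOf (F.layer w.1 w.2)).ncard : ℤ) - (τ.innerEdges w.1 (F.layer w.1 w.2)).ncard +
    (F.layer w.1 w.2).ncard

lemma linkEulerChar_le_contribution [Fintype T] {w : τ.Space × ℕ} (hw : w ∈ F.layerIndices) :
    τ.linkEulerChar w.1 ≤ F.contribution w :=
  linkEulerChar_le w.1 (layer_subset _ _) (mem_layerIndices.1 hw)

lemma isVertex_of_mem_layerIndices [Fintype T] {w : τ.Space × ℕ} (hw : w ∈ F.layerIndices) :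
    τ.IsVertex w.1 := by
  obtain ⟨c, hc⟩ := mem_layerIndices.1 hw
  exact ⟨c.1, c.2, hc.1⟩

lemma one_le_contribution [Fintype T] (hM : τ.IsManifold) {w : τ.Space × ℕ}
    (hw : w ∈ F.layerIndices) : 1 ≤ F.contribution w := by
  refine le_trans ?_ (linkEulerChar_le_contribution hw)
  have hv := isVertex_of_mem_layerIndices hw
  by_cases hb : w.1 ∈ τ.boundary
  · rw [hM.link_disc _ hv hb]
  · rw [hM.link_sphere _ hv hb]; norm_num

/-- If `F` has no quadrilaterals, each layer is a whole vertex link. If `F` is moreover closed, the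
vertex is not in the boundary and the link is a sphere. -/
lemma two_le_contribution_of_closed [Fintype T] (hM : τ.IsManifold) (hF : F.IsClosedSurface)
    (hQ : F.numQuads = 0) {w : τ.Space × ℕ} (hw : w ∈ F.layerIndices) : 2 ≤ F.contribution w := by
  refine le_trans ?_ (linkEulerChar_le_contribution hw)
  have hv := isVertex_of_mem_layerIndices hw
  suffices hb : w.1 ∉ τ.boundary by rw [hM.link_sphere _ hv hb]
  have hall : F.layer w.1 w.2 = τ.linkTriangles w.1 := by
    by_contra hne
    obtain ⟨t, f, u, σ, i, -, -, -, -, D, -, -, -, E, hE, hEq, -⟩ :=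
      exists_adj_quad (mem_layerIndices.1 hw) hne
    rw [← card_quads, Finset.card_eq_zero] at hQ
    have : (⟨u, E⟩ : Σ _ : T, Set Tet) ∈ F.quads := mem_quads.2 ⟨hE, hEq⟩
    rw [hQ] at this
    exact Finset.notMem_empty _ this
  rintro ⟨t, f, x, hadj, hxf, hx⟩
  obtain ⟨t₀, i₀, h₀⟩ := hv
  rw [cornerAt_iff] at h₀
  obtain ⟨i, rfl⟩ : ∃ i, x = Tet.vertex i := by
    refine (iff_of_char_eq (τ := τ) (fun _ x => ∃ i, x = Tet.vertex i) ?_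
      (h₀.trans hx.symm)).1 ⟨i₀, rfl⟩
    intro t f u σ x _ _
    constructor
    · rintro ⟨i, rfl⟩; exact ⟨σ i, Tet.perm_vertex σ i⟩
    · rintro ⟨i, hi⟩
      obtain ⟨i, rfl⟩ := σ.surjective i
      exact ⟨i, Tet.perm_injective σ (hi.trans (Tet.perm_vertex σ i).symm)⟩
  have hc : (t, i) ∈ F.layer w.1 w.2 := by rw [hall]; exact cornerAt_iff.2 hx
  obtain ⟨-, D, hD, hi, -⟩ := hc
  obtain ⟨y, hyD, hyf⟩ := hi.inter_face_nonempty.2 (vertex_mem_face.1 hxf)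
  exact Set.disjoint_left.1 hF (F.mem_carrier_iff.2 ⟨D, hD, hyD⟩) ⟨t, f, y, hadj, hyf, rfl⟩

/-- Suppose that distinct corners of quadrilaterals are distinct points of `M`. If one of these
points is on some layer, then there is a layer of contribution at least `2`: a triangle of it has an
arc in common with a quadrilateral, and the corresponding edge of the link is not a loop. -/
lemma exists_two_le_contribution [Fintype T] (hM : τ.IsManifold)
    (hinj : Set.InjOn (cornerPoint τ) F.quadCorners) {p : τ.Space} (hp : p ∈ F.quadVertices)
    {w : Σ _ : τ.Space × ℕ, τ.Space} (hw : F.LiesOver p w) :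
    ∃ w ∈ F.layerIndices, 2 ≤ F.contribution w := by
  obtain ⟨t, D, i, j, x, hD, hq, hx, hxe, rfl⟩ := exists_of_mem_quadVertices hp
  obtain ⟨u, k, l, y, E, hkl, hE, hk, hy, hye, rfl, hxy⟩ := hw
  have hxF := F.mem_carrier_iff.2 ⟨D, hD, hx⟩
  obtain ⟨n, hn⟩ := F.exists_isLevel (t := u) hk
  have hyn := hn.level_eq hE hy hye
  let v := τ.char u (Tet.vertex k)
  have hlayer : (u, k) ∈ F.layer v n := ⟨cornerAt_iff.2 rfl, E, hE, hk, hn⟩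
  have hmem : (v, n) ∈ F.layerIndices := mem_layerIndices.2 ⟨_, hlayer⟩
  refine ⟨(v, n), hmem, ?_⟩
  -- The corner near the quadrilateral `D` belongs to the link of `v` but not to the layer.
  have hnot : ∀ i j, x ∈ Tet.edge i j → F.view u k l y = F.view t i j x →
      F.layer v n ≠ τ.linkTriangles v := by
    intro i j hxe hview hall
    simp only [view, Sigma.mk.injEq, Prod.mk.injEq, heq_eq_eq] at hview
    have hc : (t, i) ∈ F.layer v n := by rw [hall]; exact cornerAt_iff.2 hview.1.1.symm
    obtain ⟨-, D', hD', hi, hn'⟩ := hc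
    have hij := (F.discs_normal t D hD).choose_spec.ne_of_mem_edge hx hxe
    obtain ⟨z, hz, hze⟩ := hi.exists_mem_edge hij
    have hxn : F.IsLevel t i D n := ⟨j, x, hx, hxe, by rw [← hview.1.2, hyn]⟩
    exact hi.not_quad (hn'.disc_unique hxn hD' hD hz hze hx hxe ▸ hq)
  have hne : F.layer v n ≠ τ.linkTriangles v := by
    rcases view_of_char_eq hxe hye hxF hxy with h | h
    · exact hnot i j hxe h
    · exact hnot j i (Tet.edge_comm i j ▸ hxe) h
  obtain ⟨t, f, u, σ, i, h, hif, ht, hu, D, hD, hi, hlD, E, hE, hEq, hED⟩ :=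
    exists_adj_quad ⟨_, hlayer⟩ hne
  obtain ⟨a, b, hab, hends, hai, hbi, haf, hbf⟩ : ∃ a b, a ≠ b ∧
      (Finset.univ.filter fun l => l ≠ i ∧ l ≠ f) = {a, b} ∧ i ≠ a ∧ i ≠ b ∧ a ≠ f ∧ b ≠ f := by
    clear h ht hu hi hlD hED; revert i f; decide
  have hmemE : ∀ j, j ≠ f → ∀ p ∈ D, p ∈ Tet.edge i j → Tet.perm σ p ∈ E := by
    intro j hjf p hp hpe
    have : Tet.perm σ p ∈ E ∩ Tet.face (σ f) := by
      rw [hED]; exact ⟨p, ⟨hp, Tet.edge_subset_face hif hjf hpe⟩, rfl⟩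
    exact this.1
  obtain ⟨q, hqD, hqe⟩ := hi.exists_mem_edge hai
  obtain ⟨r, hrD, hre⟩ := hi.exists_mem_edge hbi
  have hloop : τ.germ t i a ≠ τ.germ t i b := by
    intro hg
    have heq : τ.char t q = τ.char t r :=
      char_eq_of_germ_eq hai hbi hqe hre (F.mem_carrier_iff.2 ⟨D, hD, hqD⟩)
        (F.mem_carrier_iff.2 ⟨D, hD, hrD⟩) (level_eq_of_mem_disc hD hqD hqe hrD hre) hg
    rw [char_glue h (Tet.edge_subset_face hif haf hqe),
      char_glue h (Tet.edge_subset_face hif hbf hre)] at heq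
    have hqE := hmemE a haf q hqD hqe
    have hrE := hmemE b hbf r hrD hre
    have hqe' := Tet.perm_mem_edge (σ := σ).2 hqe
    have hre' := Tet.perm_mem_edge (σ := σ).2 hre
    rcases exists_mem_quadCorners hE hEq (σ i) with hc | hc
    · have := hinj (hc _ _ hqE hqe') (hc _ _ hrE hre') (by
        rw [cornerPoint_eq hE hqE hqe', cornerPoint_eq hE hrE hre', heq])
      simp [hab] at this
    · have := hinj (hc _ _ hqE hqe') (hc _ _ hrE hre') (by
        rw [Tet.edge_comm] at hqe' hre'
        rw [cornerPoint_eq hE hqE hqe', cornerPoint_eq hE hrE hre', heq])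
      simp [hab] at this
  have hlt := linkEulerChar_lt v (layer_subset v n) h hif ht hu hends hab hloop
  have hv := isVertex_of_mem_layerIndices hmem
  have hone : 1 ≤ τ.linkEulerChar v := by
    by_cases hb : v ∈ τ.boundary
    · rw [hM.link_disc _ hv hb]
    · rw [hM.link_sphere _ hv hb]; norm_num
  have : τ.linkEulerChar v < F.contribution (v, n) := hlt
  omega

/-- The inequality `χ(F) ≥ 2 - 7 Q`. -/
theorem two_sub_seven_mul_numQuads_le_eulerChar [Fintype T] (hM : τ.IsManifold)
    (hne : F.carrier.Nonempty) (hF : F.IsClosedSurface ∨ 0 < F.numQuads) :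
    2 - 7 * (F.numQuads : ℤ) ≤ F.eulerChar := by
  classical
  have hT := F.sum_ncard_layer_add_numQuads_le
  have hE := F.ncard_arcs_le
  obtain ⟨hV, hV'⟩ := F.sum_ncard_verticesOf_le
  have hP : F.quadVertices.card ≤ 4 * F.numQuads :=
    Finset.card_image_le.trans card_quadCorners.le
  have hsum : ∑ w ∈ F.layerIndices, F.contribution w =
      ((∑ w ∈ F.layerIndices, (τ.verticesOf (F.layer w.1 w.2)).ncard : ℕ) : ℤ) -
      (∑ w ∈ F.layerIndices, (τ.innerEdges w.1 (F.layer w.1 w.2)).ncard : ℕ) +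
      (∑ w ∈ F.layerIndices, (F.layer w.1 w.2).ncard : ℕ) := by
    simp only [contribution, Finset.sum_add_distrib, Finset.sum_sub_distrib, Nat.cast_sum]
  have hχ : F.eulerChar = (F.vertices.ncard : ℤ) - F.arcs.ncard +
      (∑ t, (F.discs t).ncard : ℕ) := by
    rw [eulerChar, Nat.cast_sum]
  have hle : ∀ w ∈ F.layerIndices, F.contribution w ≤ ∑ w ∈ F.layerIndices, F.contribution w :=
    fun w hw => Finset.single_le_sum (f := F.contribution)
      (fun w hw => zero_le_one.trans (one_le_contribution hM hw)) hw
  rcases Nat.eq_zero_or_pos F.numQuads with hQ | hQ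
  · have hclosed := hF.resolve_right (by omega)
    obtain ⟨w, hw⟩ : F.layerIndices.Nonempty := by
      obtain ⟨p, hp⟩ := hne
      obtain ⟨⟨t, x⟩, rfl⟩ := Quot.exists_rep p
      obtain ⟨D, hD, -⟩ := F.mem_carrier_iff.1 hp
      refine Finset.Nonempty.image ⟨⟨t, D⟩, ?_⟩ _
      rw [← card_quads, Finset.card_eq_zero] at hQ
      rw [hQ, Finset.sdiff_empty]
      exact mem_allDiscs.2 hD
    have := two_le_contribution_of_closed hM hclosed hQ hw
    have := hle w hw
    omega
  rcases F.layerIndices.eq_empty_or_nonempty with h0 | ⟨w₀, hw₀⟩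
  · rw [h0] at hE hT
    simp only [Finset.sum_empty] at hE hT
    omega
  have h1 := (one_le_contribution hM hw₀).trans (hle w₀ hw₀)
  by_cases hinj : Set.InjOn (cornerPoint τ) F.quadCorners
  · obtain ⟨p, hp⟩ : F.quadVertices.Nonempty := by
      refine Finset.Nonempty.image (Finset.card_pos.1 ?_) _
      rw [card_quadCorners]; omega
    by_cases hover : ∃ w, F.LiesOver p w
    · obtain ⟨w, hw⟩ := hover
      obtain ⟨w', hw', h2⟩ := exists_two_le_contribution hM hinj hp hw
      have := h2.trans (hle w' hw')
      omega
    · have := hV' ⟨p, hp, not_exists.1 hover⟩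
      omega
  · have hP' : F.quadVertices.card < 4 * F.numQuads := by
      rw [← card_quadCorners]
      exact lt_of_le_of_ne Finset.card_image_le fun h => hinj (Finset.card_image_iff.1 h)
    omega

end NormalSurface

theorem theorem1 {T : Type*} [Fintype T] (τ : PseudoTriangulation T) (hM : τ.IsManifold)
    (F : NormalSurface τ) (hF : F.carrier.Nonempty) :
    (F.IsClosedSurface ∨ 0 < F.numQuads → F.eulerChar ≥ 2 - 7 * (F.numQuads : ℤ)) ∧
    (∀ g : ℕ, F.IsClosedOrientableOfGenus g → (g : ℝ) ≤ 7 / 2 * (F.numQuads : ℝ)) := by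
  refine ⟨fun h => NormalSurface.two_sub_seven_mul_numQuads_le_eulerChar hM hF h, fun g hg => ?_⟩
  have h := NormalSurface.two_sub_seven_mul_numQuads_le_eulerChar hM hF (Or.inl hg.closed)
  rw [hg.euler] at h
  have h' : (2 * g : ℤ) ≤ 7 * F.numQuads := by linarith
  have h'' : (2 * g : ℝ) ≤ 7 * F.numQuads := by exact_mod_cast h'
  linarith
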